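/- Let $(Y_n)_{n\ge 0}$ be the number of comparisons of the maximum-finding Algorithm A of Chen and Hwang on $n$ processors, that is, let $(Y_n)_{n\ge0}$ be real random variables with $Y_0=Y_1=0$ almost surely and $$Y_n \stackrel{\mathcal L}{=} Y^{(1)}_{I_1^{(n)}}+Y^{(2)}_{I_2^{(n)}}+n-I_1^{(n)},\qquad n\ge 2,$$ where the sequences $(Y^{(1)}_k)_{k\ge0}$ and $(Y^{(2)}_k)_{k\ge0}$ are distributed as $(Y_k)_{k\ge0}$, the objects $(Y^{(1)}_k)$, $(Y^{(2)}_k)$, $(I_1^{(n)},I_2^{(n)})$ are independent, and $$\mathbb P\big((I_1^{(n)},I_2^{(n)})=(j,k)\big)=\begin{cases}2^{-n}, & (j,k)=(0,0),\\ \binom{n-k-1}{j-1}2^{-n}, & k\ge 0,\ 1\le j\le n-k,\\ 0,&\text{otherwise.}\end{cases}$$ For probability laws $P,Q$ on $\mathbb R$ with finite third absolute moments let $\zeta_3(P,Q)=\sup_f\left|\int f\,dP-\int f\,dQ\right|$, where $f$ runs through all $f\in C^2(\mathbb R,\mathbb R)$ with $|f''(x)-f''(y)|\le|x-y|$ for all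 $x,y\in\mathbb R$; set $\zeta_3(P,Q)=\infty$ if one of the integrals does not exist. Then there is a constant $C$ such that for all $n\ge 2$ $$\zeta_3\left(\mathcal L\left(\frac{Y_n-\mathbb E Y_n}{\sqrt{\operatorname{Var}(Y_n)}}\right),\mathcal N(0,1)\right)\le\frac{C}{\sqrt{\ln n}}.$$ Moreover $(Y_n)$ satisfies a central limit law: as $n\to\infty$, $$\frac{Y_n-\mathbb E Y_n}{\sqrt{\operatorname{Var}(Y_n)}}\xrightarrow{\ \mathcal L\ }\mathcal N(0,1),$$ and there is a constant $\sigma>0$ with $$\frac{Y_n-\mathbb E Y_n}{\sigma\sqrt{\ln n}}\xrightarrow{\ \mathcal L\ }\mathcal N(0,1).$$ -/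

import Mathlib

open MeasureTheory ProbabilityTheory Filter
open scoped ENNReal

/-- The probability that the pair of subgroup sizes `(I₁, I₂)` of an input of size `n` equals
`(j, k)`: it is `2⁻ⁿ` at `(0, 0)`, it is `binom(n - k - 1, j - 1) 2⁻ⁿ` for `k ≥ 0` and
`1 ≤ j ≤ n - k`, and it vanishes otherwise (the subtractions below are not truncated). -/
noncomputable def indexProb (n j k : ℕ) : ℝ≥0∞ :=
  if j = 0 ∧ k = 0 then 2⁻¹ ^ n
  else if 1 ≤ j ∧ j + k ≤ n then ((n - k - 1).choose (j - 1) : ℝ≥0∞) * 2⁻¹ ^ n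
  else 0

/-- The joint law of the pair of subgroup sizes `(I₁, I₂)` for an input of size `n`. -/
noncomputable def indexLaw (n : ℕ) : Measure (ℕ × ℕ) :=
  ∑ j ∈ Finset.range (n + 1), ∑ k ∈ Finset.range (n + 1),
    indexProb n j k • Measure.dirac (j, k)

/-- `(Yₙ)` is the number of comparisons of the maximum-finding algorithm: `Y₀ = Y₁ = 0` and
`Yₙ` has the law of `Y⁽¹⁾_{I₁} + Y⁽²⁾_{I₂} + n - I₁` for `n ≥ 2`, where `(I₁, I₂)` has the law
`indexLaw n`, the sequences `Y⁽¹⁾` and `Y⁽²⁾` are distributed as `Y`, and `Y⁽¹⁾`, `Y⁽²⁾`,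
`(I₁, I₂)` are independent. These three objects are realized as the coordinates of a point
`(i, ω₁, ω₂)` of the product space `(ℕ × ℕ) × Ω × Ω`. -/
structure IsComparisonCount {Ω : Type*} [MeasurableSpace Ω] (μ : Measure Ω)
    (Y : ℕ → Ω → ℝ) : Prop where
  measurable : ∀ n, Measurable (Y n)
  zero : ∀ᵐ ω ∂μ, Y 0 ω = 0
  one : ∀ᵐ ω ∂μ, Y 1 ω = 0
  recurrence : ∀ n, 2 ≤ n →
    μ.map (Y n) =
      ((indexLaw n).prod (μ.prod μ)).map (fun q : (ℕ × ℕ) × (Ω × Ω) ↦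
        Y q.1.1 q.2.1 + Y q.1.2 q.2.2 + ((n : ℝ) - (q.1.1 : ℝ)))

/-- The twice continuously differentiable functions on the line whose second derivative is
Lipschitz continuous with constant `1`. -/
def zolotarevClass : Set (ℝ → ℝ) :=
  {f | ContDiff ℝ 2 f ∧ ∀ x y : ℝ, |iteratedDeriv 2 f x - iteratedDeriv 2 f y| ≤ |x - y|}

open Classical in
/-- The Zolotarev distance `ζ₃(P, Q) = sup |∫ f dP - ∫ f dQ|` of two laws on the line, where `f`
runs through `zolotarevClass`. It takes the value `∞` if some of these integrals do not exist;
they all exist if `P` and `Q` have finite third absolute moments. -/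
noncomputable def zolotarevDist (P Q : Measure ℝ) : ℝ≥0∞ :=
  ⨆ f ∈ zolotarevClass,
    if Integrable f P ∧ Integrable f Q then ENNReal.ofReal |∫ x, f x ∂P - ∫ x, f x ∂Q| else ⊤

/-- The standardization `(X - 𝔼 X) / √(Var X)`. -/
noncomputable def standardize {Ω : Type*} [MeasurableSpace Ω] (μ : Measure Ω) (X : Ω → ℝ) :
    Ω → ℝ :=
  fun ω ↦ (X ω - ∫ ω', X ω' ∂μ) / √(variance X μ)

namespace ComparisonCount

/-- The weights `indexProb n j k` add up to `1`. -/
theorem sum_indexProb (n : ℕ) :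
    ∑ j ∈ Finset.range (n + 1), ∑ k ∈ Finset.range (n + 1), indexProb n j k = 1 := by
  have h0 : ∑ k ∈ Finset.range (n + 1), indexProb n 0 k = 2⁻¹ ^ n := by
    rw [Finset.sum_eq_single 0]
    · simp [indexProb]
    · intro k _ hk
      simp [indexProb, hk]
    · simp
  have h1 : ∀ j ∈ Finset.range n, ∑ k ∈ Finset.range (n + 1), indexProb n (j + 1) k
      = (n.choose (j + 1) : ℝ≥0∞) * 2⁻¹ ^ n := by
    intro j hj
    obtain ⟨m, rfl⟩ : ∃ m, n = m + 1 := ⟨n - 1, by have := Finset.mem_range.1 hj; omega⟩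
    have hj' : j ≤ m := by have := Finset.mem_range.1 hj; omega
    have hk : ∀ k ∈ Finset.range (m + 1 + 1), indexProb (m + 1) (j + 1) k
        = if k < m + 1 then ((m - k).choose j : ℝ≥0∞) * 2⁻¹ ^ (m + 1) else 0 := by
      intro k _
      unfold indexProb
      rw [if_neg (by omega)]
      have e : m + 1 - k - 1 = m - k := by omega
      rw [e, Nat.add_sub_cancel]
      by_cases hc : j + 1 + k ≤ m + 1
      · rw [if_pos ⟨by omega, hc⟩, if_pos (by omega)]
      · rw [if_neg (by omega)]
        split_ifs
        · rw [Nat.choose_eq_zero_of_lt (by omega)]; simp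
        · rfl
    rw [Finset.sum_congr rfl hk, Finset.sum_range_succ, if_neg (lt_irrefl _), add_zero,
      Finset.sum_congr rfl (fun k hk ↦ if_pos (Finset.mem_range.1 hk)), ← Finset.sum_mul]
    congr 1
    rw [← Nat.cast_sum]
    congr 1
    have := Finset.sum_range_reflect (fun i ↦ i.choose j) (m + 1)
    simp only [Nat.add_sub_cancel] at this
    have e2 : ∀ k ∈ Finset.range (m + 1), (m - k).choose j = (m + 1 - 1 - k).choose j := by
      intro k _; rfl
    rw [Finset.sum_congr rfl e2]
    simp only [Nat.add_sub_cancel]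
    rw [this, ← Nat.sum_Icc_choose, Finset.range_eq_Ico]
    symm
    apply Finset.sum_subset
    · intro x hx; simp only [Finset.mem_Icc, Finset.mem_Ico] at *; omega
    · intro x hx hx'
      simp only [Finset.mem_Icc, Finset.mem_Ico] at *
      exact Nat.choose_eq_zero_of_lt (by omega)
  rw [Finset.sum_range_succ', Finset.sum_congr rfl h1, h0]
  have h2 : ∑ i ∈ Finset.range (n + 1), (n.choose i : ℝ≥0∞) * 2⁻¹ ^ n = 1 := by
    rw [← Finset.sum_mul, ← Nat.cast_sum, Nat.sum_range_choose]
    push_cast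
    rw [← mul_pow, ENNReal.mul_inv_cancel (by simp) (by simp), one_pow]
  rw [Finset.sum_range_succ'] at h2
  simpa using h2

instance isProbabilityMeasure_indexLaw (n : ℕ) : IsProbabilityMeasure (indexLaw n) := by
  constructor
  simpa [indexLaw] using sum_indexProb n

/-- An auxiliary notion for the existence proof: the law of `x + y + (n - j)` for independent `x ∼ P`,
`y ∼ Q`. -/
noncomputable def step (n j : ℕ) (P Q : Measure ℝ) : Measure ℝ :=
  (P.prod Q).map (fun q : ℝ × ℝ ↦ q.1 + q.2 + ((n : ℝ) - (j : ℝ)))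

/-- The law of the number of comparisons, computed by recursion on `n`; it is only used to show
that sequences as in `IsComparisonCount` exist. -/
noncomputable def countLaw (n : ℕ) : Measure ℝ :=
  if n < 2 then Measure.dirac 0
  else (1 - 2⁻¹ ^ n : ℝ≥0∞)⁻¹ • ∑ j : Fin n, ∑ k : Fin n,
    indexProb n j k • step n j (countLaw j) (countLaw k)
termination_by n
decreasing_by all_goals omega

theorem sum_split (n : ℕ) (hn : 2 ≤ n) {M : Type*} [AddCommMonoid M] [Module ℝ≥0∞ M]
    (T : ℕ → ℕ → M) :
    ∑ j ∈ Finset.range (n + 1), ∑ k ∈ Finset.range (n + 1), indexProb n j k • T j k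
    = (∑ j : Fin n, ∑ k : Fin n, indexProb n j k • T j k) + (2⁻¹ ^ n : ℝ≥0∞) • T n 0 := by
  have hz : ∀ j k, n < j + k → indexProb n j k = 0 := by
    intro j k h
    unfold indexProb
    rw [if_neg (by omega), if_neg (by omega)]
  have h0 : indexProb n 0 n = 0 := by
    unfold indexProb
    rw [if_neg (by omega), if_neg (by omega)]
  have hn0 : indexProb n n 0 = 2⁻¹ ^ n := by
    unfold indexProb
    rw [if_neg (by omega), if_pos (by omega)]
    simp
  rw [Finset.sum_range_succ]
  congr 1
  · rw [Finset.sum_range]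
    refine Finset.sum_congr rfl fun j _ ↦ ?_
    rw [Finset.sum_range_succ, Finset.sum_range]
    have : indexProb n j n = 0 := by
      rcases Nat.eq_zero_or_pos (j : ℕ) with h | h
      · rw [h, h0]
      · exact hz _ _ (by omega)
    simp [this]
  · rw [Finset.sum_eq_single 0]
    · rw [hn0]
    · intro k _ hk
      rw [hz _ _ (by omega), zero_smul]
    · simp

theorem qpos (n : ℕ) (hn : 2 ≤ n) : (1 - 2⁻¹ ^ n : ℝ≥0∞) ≠ 0 ∧ (1 - 2⁻¹ ^ n : ℝ≥0∞) ≠ ⊤ := by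
  constructor
  · have : (2⁻¹ ^ n : ℝ≥0∞) < 1 := pow_lt_one₀ (by simp) (ENNReal.inv_lt_one.2 (by norm_num)) (by omega)
    exact (tsub_pos_of_lt this).ne'
  · exact ne_top_of_le_ne_top ENNReal.one_ne_top tsub_le_self

theorem step_univ (n j : ℕ) (P Q : Measure ℝ) [IsProbabilityMeasure P] [IsProbabilityMeasure Q] :
    step n j P Q Set.univ = 1 := by
  unfold step
  rw [Measure.map_apply (by fun_prop) MeasurableSet.univ]
  simp

theorem countLaw_prob (n : ℕ) : IsProbabilityMeasure (countLaw n) := by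
  induction n using Nat.strong_induction_on with
  | _ n ih =>
    rw [countLaw]
    split_ifs with h
    · infer_instance
    · constructor
      have h2 : 2 ≤ n := by omega
      have hs := sum_split n h2 (fun _ _ ↦ (1 : ℝ≥0∞))
      simp only [smul_eq_mul, mul_one, sum_indexProb] at hs
      have hle : (2⁻¹ ^ n : ℝ≥0∞) ≠ ⊤ := by simp
      have e : ∑ j : Fin n, ∑ k : Fin n, indexProb n j k = 1 - 2⁻¹ ^ n :=
        (ENNReal.sub_eq_of_eq_add hle hs).symm
      have : ∀ j k : Fin n, step n j (countLaw j) (countLaw k) Set.univ = 1 := by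
        intro j k
        have := ih j j.2
        have := ih k k.2
        exact step_univ _ _ _ _
      simp only [Measure.smul_apply, Measure.finsetSum_apply, this, smul_eq_mul, mul_one, e]
      exact ENNReal.inv_mul_cancel (qpos n h2).1 (qpos n h2).2

theorem countLaw_eq (n : ℕ) (hn : 2 ≤ n) :
    countLaw n = ∑ j ∈ Finset.range (n + 1), ∑ k ∈ Finset.range (n + 1),
      indexProb n j k • step n j (countLaw j) (countLaw k) := by
  have := countLaw_prob n
  rw [sum_split n hn (fun j k ↦ step n j (countLaw j) (countLaw k))]
  have hT : step n n (countLaw n) (countLaw 0) = countLaw n := by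
    have : countLaw 0 = Measure.dirac 0 := by rw [countLaw]; simp
    rw [this, step, Measure.prod_dirac, Measure.map_map (by fun_prop) (by fun_prop)]
    convert Measure.map_id using 2
    ext x; simp
  have hS : ∑ j : Fin n, ∑ k : Fin n, indexProb n j k • step n j (countLaw j) (countLaw k)
      = (1 - 2⁻¹ ^ n : ℝ≥0∞) • countLaw n := by
    conv_rhs => rw [countLaw, if_neg (by omega)]
    rw [smul_smul, ENNReal.mul_inv_cancel (qpos n hn).1 (qpos n hn).2, one_smul]
  rw [hT, hS, ← add_smul, tsub_add_cancel_of_le, one_smul]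
  exact pow_le_one₀ (by simp) (by simp)

/-- Sequences satisfying `IsComparisonCount` exist. -/
theorem exists_isComparisonCount :
    ∃ μ : ProbabilityMeasure (ℕ → ℝ), IsComparisonCount (μ : Measure (ℕ → ℝ)) (fun n ω ↦ ω n) := by
  have := countLaw_prob
  refine ⟨⟨Measure.infinitePi countLaw, inferInstance⟩, ?_⟩
  have hm : ∀ n, (Measure.infinitePi countLaw).map (fun ω ↦ ω n) = countLaw n :=
    fun n ↦ Measure.infinitePi_map_eval (μ := countLaw) n
  have hz : ∀ n < 2, ∀ᵐ ω ∂(Measure.infinitePi countLaw), ω n = 0 := by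
    intro n hn
    have h1 : ∀ᵐ x ∂(countLaw n), x = 0 := by
      rw [countLaw, if_pos hn]
      simp [ae_dirac_eq]
    rw [← hm n] at h1
    exact ae_of_ae_map (measurable_pi_apply n).aemeasurable h1
  refine ⟨fun n ↦ by fun_prop, hz 0 (by norm_num), hz 1 (by norm_num), fun n hn ↦ ?_⟩
  simp only [ProbabilityMeasure.coe_mk]
  rw [hm, countLaw_eq n hn]
  have hF : Measurable (fun q : (ℕ × ℕ) × ((ℕ → ℝ) × (ℕ → ℝ)) ↦
      q.2.1 q.1.1 + q.2.2 q.1.2 + ((n : ℝ) - (q.1.1 : ℝ))) := by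
    refine measurable_from_prod_countable_right fun i ↦ ?_
    have h1 : Measurable fun y : (ℕ → ℝ) × (ℕ → ℝ) ↦ y.1 i.1 :=
      (measurable_pi_apply i.1).comp measurable_fst
    have h2 : Measurable fun y : (ℕ → ℝ) × (ℕ → ℝ) ↦ y.2 i.2 :=
      (measurable_pi_apply i.2).comp measurable_snd
    exact ((h1.add h2).add_const ((n : ℝ) - (i.1 : ℝ)))
  set ρ := Measure.infinitePi countLaw
  ext s hs
  rw [Measure.map_apply hF hs, Measure.prod_apply (hF hs)]
  simp only [indexLaw, lintegral_finsetSum_measure, lintegral_smul_measure, lintegral_dirac,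
    Measure.finsetSum_apply, Measure.smul_apply, smul_eq_mul]
  refine Finset.sum_congr rfl fun j _ ↦ Finset.sum_congr rfl fun k _ ↦ ?_
  congr 1
  rw [step, ← hm j, ← hm k, Measure.map_prod_map _ _ (by fun_prop) (by fun_prop),
    Measure.map_map (by fun_prop) (by fun_prop), Measure.map_apply (by fun_prop) hs]
  rfl

end ComparisonCount

/-!
Let `mₙ` and `vₙ` be the mean and the variance of `Yₙ - n`. The recursion says that `Yₙ - n` has
the law of `(Y⁽¹⁾_{I₁} - I₁) + Y⁽²⁾_{I₂}`. The first group size `I₁` is binomial with parameters `n`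
and `1/2`; the second, `I₂`, is geometric up to a cut-off at `n`. So `Yₙ - n` is a sum of about
`log₂ n` contributions with bounded moments, collected along a chain of sizes roughly halved in
each step. After centering, the recursion adds to the first group the increment
`D = m_{I₁} - mₙ + Y⁽²⁾_{I₂}`, which has mean zero, and `vₙ = 𝔼 v_{I₁} + 𝔼 D²`.

*Reduction to finite sums.* The recursion forces `Yₙ` to be an integer between `0` and `n²`
(`IsComparisonCount.ae_mem_countValues`). All expectations are then finite weighted sums
(`IsCountLaw`), and no question of integrability arises.

*Moments.* The binomial average `binE n` of the harmonic numbers is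
`Hₙ - ∑_{i ≤ n} 2⁻ⁱ / i` exactly (`binE_harmonic`), so harmonic numbers are comparison functions for
recursive inequalities with binomial averages (`le_of_le_binE_step`). Size biasing turns the recursion
for `mₙ` into one for `n (mₙ - mₙ₋₁)`, which is therefore bounded
(`IsCountLaw.exists_abs_excess_succ_sub_le`). By the Efron–Stein inequality `m_{I₁}` then has
variance `O(1/n)`, so `𝔼 D²` converges with rate `1/√n` to the variance of `Y_G`, for `G` geometric
(`IsCountLaw.exists_abs_incrementVar_sub_le`), and `vₙ = s Hₙ + O(1)` with `s > 0`
(`IsCountLaw.exists_abs_countVar_sub_le`). The same estimates bound `𝔼 |D|³` and the variance of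
`v_{I₁}`.

*Normal approximation.* Let `f''` be Lipschitz with constant `1`. If the first group is replaced by
a centered normal variable with the variance `v_{I₁}`, a Taylor expansion in the space variable and in
the variance shows that the result differs from the normal law with variance `vₙ` by `O(1)` on `f`
(`IsCountLaw.exists_abs_stepE_gaussE_sub_le`): the terms of orders one and two cancel because of
`𝔼 D = 0` and the recursion for `vₙ`. Since the class of test functions is invariant under
translation, the errors of the first group are inherited, and the comparison principle bounds the
total error by a multiple of `Hₙ` (`IsCountLaw.exists_abs_countE_sub_gaussE_le`). Standardization
divides it by `vₙ^{3/2}`, which leaves `O(1 / √(log n))`.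

*Weak convergence.* The functions `cos (t x) / |t|³` and `sin (t x) / |t|³` are test functions, so
the bound yields convergence of characteristic functions, and Lévy's theorem applies. As the bound
is locally uniform in `t`, the standard deviation may be replaced by the equivalent `√(s log n)`.
-/

namespace ComparisonCount

/-! ### Averages -/

/-- A functional on the real functions on `ι` that is an average: linear, monotone, and equal to
`c` on the constant function `c`. -/
structure IsMean {ι : Type*} (E : (ι → ℝ) → ℝ) : Prop where
  add : ∀ f g : ι → ℝ, E (fun i ↦ f i + g i) = E f + E g
  const_mul : ∀ (c : ℝ) (f : ι → ℝ), E (fun i ↦ c * f i) = c * E f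
  mono : ∀ f g : ι → ℝ, (∀ i, f i ≤ g i) → E f ≤ E g
  const : ∀ c : ℝ, E (fun _ ↦ c) = c

namespace IsMean

variable {ι : Type*} {E : (ι → ℝ) → ℝ}

theorem sub (hE : IsMean E) (f g : ι → ℝ) : E (fun i ↦ f i - g i) = E f - E g := by
  have h := hE.add (fun i ↦ f i - g i) g
  simp only [sub_add_cancel] at h
  linarith

theorem add_const (hE : IsMean E) (f : ι → ℝ) (c : ℝ) : E (fun i ↦ f i + c) = E f + c := by
  rw [hE.add f fun _ ↦ c, hE.const]

theorem sub_const (hE : IsMean E) (f : ι → ℝ) (c : ℝ) : E (fun i ↦ f i - c) = E f - c := by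
  rw [hE.sub f fun _ ↦ c, hE.const]

theorem nonneg (hE : IsMean E) {f : ι → ℝ} (hf : ∀ i, 0 ≤ f i) : 0 ≤ E f := by
  simpa [hE.const] using hE.mono (fun _ ↦ 0) f hf

theorem abs_le (hE : IsMean E) (f : ι → ℝ) : |E f| ≤ E (fun i ↦ |f i|) := by
  rw [_root_.abs_le]
  constructor
  · have h := hE.mono (fun i ↦ (-1) * |f i|) f fun i ↦ by linarith [neg_abs_le (f i)]
    rw [hE.const_mul] at h
    linarith
  · exact hE.mono _ _ fun i ↦ le_abs_self _

/-- The mean square deviation from the mean is the second moment minus the squared mean. -/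
theorem sq_sub_mean (hE : IsMean E) (f : ι → ℝ) :
    E (fun i ↦ (f i - E f) ^ 2) = E (fun i ↦ f i ^ 2) - E f ^ 2 := by
  have h : (fun i ↦ (f i - E f) ^ 2) = fun i ↦ f i ^ 2 - (2 * E f) * f i + E f ^ 2 := by
    funext i; ring
  rw [h, hE.add_const, hE.sub, hE.const_mul]
  ring

/-- The mean square deviation is smallest around the mean. -/
theorem sq_sub_mean_le (hE : IsMean E) (f : ι → ℝ) (c : ℝ) :
    E (fun i ↦ (f i - E f) ^ 2) ≤ E (fun i ↦ (f i - c) ^ 2) := by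
  have h : (fun i ↦ (f i - c) ^ 2) = fun i ↦ f i ^ 2 - (2 * c) * f i + c ^ 2 := by
    funext i; ring
  rw [hE.sq_sub_mean, h, hE.add_const, hE.sub, hE.const_mul]
  nlinarith [sq_nonneg (E f - c)]

end IsMean

theorem isMean_sum {ι : Type*} (s : Finset ι) (w : ι → ℝ) (hw : ∀ i ∈ s, 0 ≤ w i)
    (h1 : ∑ i ∈ s, w i = 1) : IsMean (fun f : ι → ℝ ↦ ∑ i ∈ s, w i * f i) where
  add f g := by simp only [mul_add, Finset.sum_add_distrib]
  const_mul c f := by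
    rw [Finset.mul_sum]
    exact Finset.sum_congr rfl fun i _ ↦ by ring
  mono f g h := Finset.sum_le_sum fun i hi ↦ mul_le_mul_of_nonneg_left (h i) (hw i hi)
  const c := by rw [← Finset.sum_mul, h1, one_mul]

/-! ### Binomial averages -/

/-- The average of `x` under the binomial law with `n` trials and success probability `1/2`. -/
noncomputable def binE (n : ℕ) (x : ℕ → ℝ) : ℝ :=
  ∑ j ∈ Finset.range (n + 1), (n.choose j / 2 ^ n : ℝ) * x j

theorem isMean_binE (n : ℕ) : IsMean (binE n) := by
  refine isMean_sum _ _ (fun i _ ↦ by positivity) ?_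
  rw [← Finset.sum_div, ← Nat.cast_sum, Nat.sum_range_choose]
  push_cast
  exact div_self (by positivity)

theorem binE_mono {n : ℕ} {x y : ℕ → ℝ} (h : ∀ j ≤ n, x j ≤ y j) : binE n x ≤ binE n y :=
  Finset.sum_le_sum fun j hj ↦ mul_le_mul_of_nonneg_left
    (h j (Nat.lt_succ_iff.1 (Finset.mem_range.1 hj))) (by positivity)

theorem binE_zero (x : ℕ → ℝ) : binE 0 x = x 0 := by simp [binE]

/-- Conditioning on the first trial. -/
theorem binE_succ (n : ℕ) (x : ℕ → ℝ) :
    binE (n + 1) x = (binE n x + binE n (fun j ↦ x (j + 1))) / 2 := by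
  have h1 : binE n x = ∑ j ∈ Finset.range (n + 1 + 1), (n.choose j / 2 ^ n : ℝ) * x j := by
    rw [Finset.sum_range_succ _ (n + 1)]; simp [binE]
  rw [h1, Finset.sum_range_succ']
  unfold binE
  rw [Finset.sum_range_succ', add_right_comm, ← Finset.sum_add_distrib, add_div, Finset.sum_div]
  congr 1
  · refine Finset.sum_congr rfl fun j _ ↦ ?_
    rw [Nat.choose_succ_succ]
    push_cast
    rw [pow_succ]
    field_simp
    ring
  · simp [pow_succ]
    field_simp

/-- Size biasing: `binom(n, j) / (j + 1) = binom(n + 1, j + 1) / (n + 1)`. -/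
theorem binE_div_succ (n : ℕ) (x : ℕ → ℝ) :
    binE n (fun j ↦ x (j + 1) / (j + 1)) = 2 / (n + 1) * (binE (n + 1) x - x 0 / 2 ^ (n + 1)) := by
  unfold binE
  rw [Finset.sum_range_succ' _ (n + 1)]
  simp only [Nat.choose_zero_right, Nat.cast_one]
  rw [show (1 / 2 ^ (n + 1) : ℝ) * x 0 = x 0 / 2 ^ (n + 1) by ring, add_sub_cancel_right,
    Finset.mul_sum]
  refine Finset.sum_congr rfl fun j _ ↦ ?_
  have h := Nat.add_one_mul_choose_eq n j
  have h' : ((n : ℝ) + 1) * n.choose j = (n + 1).choose (j + 1) * (j + 1) := by exact_mod_cast h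
  have : (n.choose j : ℝ) = (n + 1).choose (j + 1) * (j + 1) / (n + 1) := by
    rw [← h']; field_simp
  rw [this, pow_succ]
  field_simp

theorem binE_one_div_succ (n : ℕ) :
    binE n (fun j ↦ 1 / ((j : ℝ) + 1)) = 2 / (n + 1) * (1 - 1 / 2 ^ (n + 1)) := by
  have h := binE_div_succ n (fun _ ↦ 1)
  rwa [(isMean_binE (n + 1)).const] at h

theorem binE_one_div_sq_le (n : ℕ) :
    binE n (fun j ↦ (1 / ((j : ℝ) + 1)) ^ 2) ≤ 8 / ((n + 1) * (n + 2)) := by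
  have h1 : binE n (fun j ↦ (1 / ((j : ℝ) + 1)) ^ 2)
      ≤ 2 * binE n (fun j ↦ (1 / (((j + 1 : ℕ) : ℝ) + 1)) / (j + 1)) := by
    rw [← (isMean_binE n).const_mul]
    refine (isMean_binE n).mono _ _ fun j ↦ ?_
    push_cast
    rw [div_pow, div_div, ← mul_div_assoc, div_le_div_iff₀ (by positivity) (by positivity)]
    nlinarith [(Nat.cast_nonneg j : (0 : ℝ) ≤ j)]
  have h2 := binE_div_succ n (fun j ↦ 1 / ((j : ℝ) + 1))
  have h3 := binE_one_div_succ (n + 1)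
  rw [h2, h3] at h1
  refine h1.trans ?_
  push_cast
  have h4 : 2 / ((n : ℝ) + 1 + 1) * (1 - 1 / 2 ^ (n + 1 + 1)) - 1 / (0 + 1) / 2 ^ (n + 1)
      ≤ 2 / ((n : ℝ) + 2) := by
    have : 2 / ((n : ℝ) + 1 + 1) * (1 - 1 / 2 ^ (n + 1 + 1)) ≤ 2 / ((n : ℝ) + 1 + 1) * 1 := by
      gcongr
      have : (0 : ℝ) ≤ 1 / 2 ^ (n + 1 + 1) := by positivity
      linarith
    have h5 : (0 : ℝ) ≤ 1 / (0 + 1) / 2 ^ (n + 1) := by positivity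
    rw [show (n : ℝ) + 1 + 1 = n + 2 by ring] at this ⊢
    linarith
  calc _ ≤ 2 * (2 / ((n : ℝ) + 1) * (2 / ((n : ℝ) + 2))) := by gcongr
    _ = _ := by field_simp; norm_num

/-- The Efron–Stein inequality for a function of a binomial variable. -/
theorem binE_sq_sub_mean_le (n : ℕ) (x : ℕ → ℝ) :
    binE (n + 1) (fun j ↦ (x j - binE (n + 1) x) ^ 2)
      ≤ (n + 1) / 4 * binE n (fun j ↦ (x (j + 1) - x j) ^ 2) := by
  induction n generalizing x with
  | zero =>
    simp only [binE_succ, binE_zero]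
    norm_num
    nlinarith [sq_nonneg (x 1 - x 0)]
  | succ n ih =>
    have h1 := ih x
    have h2 := ih fun j ↦ x (j + 1)
    rw [(isMean_binE _).sq_sub_mean] at h1 h2 ⊢
    rw [binE_succ (n + 1) x, binE_succ (n + 1) (fun j ↦ x j ^ 2)]
    have h3 : (binE (n + 1) (fun j ↦ x (j + 1)) - binE (n + 1) x) ^ 2
        ≤ binE (n + 1) (fun j ↦ (x (j + 1) - x j) ^ 2) := by
      rw [← (isMean_binE _).sub]
      have := (isMean_binE (n + 1)).sq_sub_mean (fun j ↦ x (j + 1) - x j)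
      have h0 := (isMean_binE (n + 1)).nonneg
        (f := fun j ↦ (x (j + 1) - x j - binE (n + 1) (fun j ↦ x (j + 1) - x j)) ^ 2)
        fun j ↦ sq_nonneg _
      linarith
    have h4 := binE_succ n (fun j ↦ (x (j + 1) - x j) ^ 2)
    have h5 := congrArg (fun z ↦ ((n : ℝ) + 1) / 4 * z) h4
    push_cast at h1 h2 h5 ⊢
    linarith

/-! ### Harmonic numbers -/

/-- The difference between the harmonic number `Hₙ` and its binomial average. -/
noncomputable def harmonicGap (n : ℕ) : ℝ := ∑ i ∈ Finset.range n, (1 / 2 : ℝ) ^ (i + 1) / (i + 1)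

theorem harmonic_cast_succ (n : ℕ) :
    ((harmonic (n + 1) : ℚ) : ℝ) = (harmonic n : ℝ) + 1 / ((n : ℝ) + 1) := by
  rw [harmonic_succ]; push_cast; ring

theorem binE_harmonic (n : ℕ) :
    binE n (fun j ↦ (harmonic j : ℝ)) = (harmonic n : ℝ) - harmonicGap n := by
  induction n with
  | zero => simp [binE_zero, harmonicGap]
  | succ n ih =>
    rw [binE_succ]
    simp only [harmonic_cast_succ]
    rw [(isMean_binE n).add (fun j ↦ (harmonic j : ℝ)) (fun j ↦ 1 / ((j : ℝ) + 1)), ih,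
      binE_one_div_succ, harmonicGap, harmonicGap, Finset.sum_range_succ]
    rw [one_div_pow]
    field_simp
    ring

theorem half_le_harmonicGap {n : ℕ} (hn : 1 ≤ n) : 1 / 2 ≤ harmonicGap n := by
  have h := Finset.single_le_sum (f := fun i : ℕ ↦ (1 / 2 : ℝ) ^ (i + 1) / (i + 1))
    (fun i _ ↦ by positivity) (Finset.mem_range.2 hn)
  simpa [harmonicGap] using h

theorem abs_harmonicGap_sub_le (n : ℕ) : |harmonicGap n - Real.log 2| ≤ (1 / 2) ^ n := by
  have h := Real.abs_log_sub_add_sum_range_le (x := 1 / 2) (by rw [abs_of_pos] <;> norm_num) n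
  have h2 : Real.log (1 - 1 / 2) = - Real.log 2 := by
    rw [← Real.log_inv]; norm_num
  rw [h2, abs_of_pos (by norm_num : (0 : ℝ) < 1 / 2)] at h
  refine h.trans (le_of_eq ?_)
  rw [pow_succ]; norm_num

theorem harmonic_mono : Monotone fun n ↦ (harmonic n : ℝ) :=
  monotone_nat_of_le_succ fun n ↦ by
    rw [harmonic_cast_succ]
    have : (0 : ℝ) ≤ 1 / (n + 1) := by positivity
    linarith

theorem harmonic_nonneg (n : ℕ) : 0 ≤ (harmonic n : ℝ) := by
  simpa using harmonic_mono (Nat.zero_le n)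

/-- The third absolute moment of `Hₙ - H_B`, for a binomial variable `B`, is bounded. The
comparison `x³ ≤ 6 eˣ` reduces it to the mean of `1 / (B + 1)`. -/
theorem binE_harmonic_sub_pow_three_le (n : ℕ) :
    binE n (fun j ↦ ((harmonic n : ℝ) - harmonic j) ^ 3) ≤ 12 * Real.exp 1 := by
  have h1 : binE n (fun j ↦ ((harmonic n : ℝ) - harmonic j) ^ 3)
      ≤ (6 * Real.exp 1 * (n + 1)) * binE n (fun j ↦ 1 / ((j : ℝ) + 1)) := by
    rw [← (isMean_binE n).const_mul]
    refine binE_mono fun j hj ↦ ?_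
    have h0 : 0 ≤ (harmonic n : ℝ) - harmonic j := sub_nonneg.2 (harmonic_mono hj)
    have h2 := Real.pow_div_factorial_le_exp _ h0 3
    have h3 : (harmonic n : ℝ) ≤ 1 + Real.log (n + 1) := by
      refine (harmonic_le_one_add_log n).trans ?_
      rcases Nat.eq_zero_or_pos n with rfl | hn
      · simp
      · have : (0 : ℝ) < n := by exact_mod_cast hn
        gcongr
        linarith
    have h4 := log_add_one_le_harmonic j
    push_cast at h4
    have h5 : Real.exp ((harmonic n : ℝ) - harmonic j) ≤ Real.exp 1 * (n + 1) * (1 / (j + 1)) := by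
      have hnp : (0 : ℝ) < (n : ℝ) + 1 := by positivity
      have hjp : (0 : ℝ) < (j : ℝ) + 1 := by positivity
      calc Real.exp ((harmonic n : ℝ) - harmonic j)
          ≤ Real.exp (1 + Real.log (n + 1) - Real.log (j + 1)) := by gcongr
        _ = _ := by
          rw [Real.exp_sub, Real.exp_add, Real.exp_log hnp, Real.exp_log hjp]; ring
    have h6 : ((Nat.factorial 3 : ℕ) : ℝ) = 6 := by norm_num [Nat.factorial]
    rw [h6, div_le_iff₀ (by norm_num)] at h2
    nlinarith
  refine h1.trans ?_
  rw [binE_one_div_succ]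
  have h2 : (1 - 1 / 2 ^ (n + 1) : ℝ) ≤ 1 := by
    have : (0 : ℝ) ≤ 1 / 2 ^ (n + 1) := by positivity
    linarith
  calc _ ≤ 6 * Real.exp 1 * (n + 1) * (2 / (n + 1) * 1) := by gcongr
    _ = _ := by field_simp; norm_num

/-! ### Comparison principle -/

/-- The last summand of a binomial average split off. -/
theorem binE_eq_sum_add (n : ℕ) (x : ℕ → ℝ) :
    binE n x = ∑ j ∈ Finset.range n, (n.choose j / 2 ^ n : ℝ) * x j + x n / 2 ^ n := by
  rw [binE, Finset.sum_range_succ]; simp [div_eq_inv_mul]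

/-- One step of the comparison principle: the weight `2⁻ⁿ` of the unknown itself is absorbed. -/
theorem le_of_le_binE_step {n : ℕ} (hn : 1 ≤ n) {h : ℕ → ℝ} {y e : ℝ}
    (hy : y ≤ ∑ j ∈ Finset.range n, (n.choose j / 2 ^ n : ℝ) * h j + y / 2 ^ n + e)
    (hh : binE n h + e ≤ h n) : y ≤ h n := by
  rw [binE_eq_sum_add] at hh
  have h2 : (1 : ℝ) < 2 ^ n := one_lt_pow₀ (by norm_num) (by omega)
  have h3 : (y - h n) ≤ (y - h n) / 2 ^ n := by rw [sub_div]; linarith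
  by_contra hc
  have h4 : 0 < y - h n := by linarith [not_le.1 hc]
  have := div_lt_self h4 h2
  linarith

/-- The comparison principle for recursive inequalities with binomial averages. -/
theorem le_of_le_binE {n₀ : ℕ} (h₀ : 1 ≤ n₀) {x h e : ℕ → ℝ} (hb : ∀ n < n₀, x n ≤ h n)
    (hx : ∀ n, n₀ ≤ n → x n ≤ binE n x + e n) (hh : ∀ n, n₀ ≤ n → binE n h + e n ≤ h n) (n : ℕ) :
    x n ≤ h n := by
  induction n using Nat.strong_induction_on with
  | _ n ih =>
    rcases lt_or_ge n n₀ with hn | hn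
    · exact hb n hn
    refine le_of_le_binE_step (e := e n) (h₀.trans hn) ?_ (hh n hn)
    have := hx n hn
    rw [binE_eq_sum_add] at this
    refine this.trans ?_
    gcongr with j hj
    exact ih j (Finset.mem_range.1 hj)

theorem exists_forall_lt_le (x : ℕ → ℝ) (n₀ : ℕ) : ∃ K, 0 ≤ K ∧ ∀ n < n₀, x n ≤ K := by
  refine ⟨∑ i ∈ Finset.range n₀, |x i|, Finset.sum_nonneg fun _ _ ↦ abs_nonneg _, fun n hn ↦ ?_⟩
  exact (le_abs_self _).trans
    (Finset.single_le_sum (f := fun i ↦ |x i|) (fun _ _ ↦ abs_nonneg _) (Finset.mem_range.2 hn))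

/-- The binomial average of `1 / √(j + 1)` exceeds `1 / √(n + 1)` by a fixed factor: a tangent of
the convex function `1 / √x` at the mean `n / 2 + 1` of `j + 1` gives the lower bound
`1 / √(n / 2 + 1)`. -/
theorem le_binE_one_div_sqrt {n : ℕ} (hn : 1 ≤ n) :
    (1 + 1 / 8) * (1 / √((n : ℝ) + 1)) ≤ binE n (fun j ↦ 1 / √((j : ℝ) + 1)) := by
  have hid : binE n (fun j ↦ (j : ℝ)) = n / 2 := by
    clear hn
    induction n with
    | zero => simp [binE_zero]
    | succ n ih =>
      rw [binE_succ]
      push_cast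
      rw [(isMean_binE n).add_const (fun j ↦ (j : ℝ)), ih]
      ring
  set s := √((n : ℝ) / 2 + 1) with hs
  have hsp : 0 < s := Real.sqrt_pos.2 (by positivity)
  have hss : s ^ 2 = n / 2 + 1 := Real.sq_sqrt (by positivity)
  have h1 : 1 / s ≤ binE n (fun j ↦ 1 / √((j : ℝ) + 1)) := by
    have h2 : binE n (fun j ↦ (-(1 / (2 * s ^ 3))) * (j : ℝ) + (3 / (2 * s) - 1 / (2 * s ^ 3)))
        ≤ binE n (fun j ↦ 1 / √((j : ℝ) + 1)) := by
      refine (isMean_binE n).mono _ _ fun j ↦ ?_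
      set r := √((j : ℝ) + 1) with hr
      have hrp : 0 < r := Real.sqrt_pos.2 (by positivity)
      have hrr : r ^ 2 = j + 1 := Real.sq_sqrt (by positivity)
      have hj : (j : ℝ) = r ^ 2 - 1 := by linarith
      rw [hj]
      have : 1 / r - (-(1 / (2 * s ^ 3)) * (r ^ 2 - 1) + (3 / (2 * s) - 1 / (2 * s ^ 3)))
          = (s - r) ^ 2 * (2 * s + r) / (2 * s ^ 3 * r) := by
        field_simp; ring
      have h3 : 0 ≤ (s - r) ^ 2 * (2 * s + r) / (2 * s ^ 3 * r) := by positivity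
      linarith
    rw [(isMean_binE n).add_const, (isMean_binE n).const_mul, hid] at h2
    refine le_trans (le_of_eq ?_) h2
    have hn2 : (n : ℝ) / 2 = s ^ 2 - 1 := by linarith
    rw [hn2]
    field_simp
    ring
  refine le_trans ?_ h1
  rw [mul_one_div, div_le_div_iff₀ (Real.sqrt_pos.2 (by positivity)) hsp, one_mul]
  have hn' : (1 : ℝ) ≤ n := by exact_mod_cast hn
  rw [Real.le_sqrt (by positivity) (by positivity), mul_pow, hss]
  nlinarith

/-- Solutions of the recursion with an inhomogeneity of order `1 / √n` are bounded; the majorant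
is `K - 8 L / √(n + 1)`. -/
theorem exists_abs_le_of_abs_sub_binE_le {x : ℕ → ℝ} {L : ℝ} {n₀ : ℕ} (h₀ : 1 ≤ n₀)
    (hx : ∀ n, n₀ ≤ n → |x n - binE n x| ≤ L / √((n : ℝ) + 1)) :
    ∃ K, 0 ≤ K ∧ ∀ n, |x n| ≤ K := by
  have hL : 0 ≤ L := by
    have := (abs_nonneg _).trans (hx n₀ le_rfl)
    by_contra hc
    have h2 := div_neg_of_neg_of_pos (not_le.1 hc)
      (Real.sqrt_pos.2 (by positivity : (0 : ℝ) < (n₀ : ℝ) + 1))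
    linarith
  have key : ∀ y : ℕ → ℝ, (∀ n, n₀ ≤ n → |y n - binE n y| ≤ L / √((n : ℝ) + 1)) →
      ∃ K, 0 ≤ K ∧ ∀ n, y n ≤ K := by
    intro y hy
    obtain ⟨K, hK0, hK⟩ := exists_forall_lt_le y n₀
    have hle : ∀ n : ℕ, 1 / √((n : ℝ) + 1) ≤ 1 := fun n ↦ by
      rw [div_le_one (Real.sqrt_pos.2 (by positivity)), Real.one_le_sqrt]
      linarith [(Nat.cast_nonneg n : (0 : ℝ) ≤ n)]
    refine ⟨K + 8 * L, by positivity, fun n ↦ ?_⟩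
    have := le_of_le_binE h₀ (x := y) (h := fun n ↦ (-(8 * L)) * (1 / √((n : ℝ) + 1)) + (K + 8 * L))
      (e := fun n ↦ L / √((n : ℝ) + 1)) (fun n hn ↦ ?_) (fun n hn ↦ ?_) (fun n hn ↦ ?_) n
    · refine this.trans ?_
      have h2 : 0 ≤ 8 * L * (1 / √((n : ℝ) + 1)) := by positivity
      linarith
    · have := hK n hn
      have h2 := hle n
      nlinarith
    · have := (abs_le.1 (hy n hn)).2
      linarith
    · rw [(isMean_binE n).add_const, (isMean_binE n).const_mul]
      have h3 := le_binE_one_div_sqrt (h₀.trans hn)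
      rw [show L / √((n : ℝ) + 1) = L * (1 / √((n : ℝ) + 1)) by ring]
      nlinarith
  obtain ⟨K, hK0, hK⟩ := key x hx
  obtain ⟨K', hK0', hK'⟩ := key (fun n ↦ (-1) * x n) fun n hn ↦ by
    rw [(isMean_binE n).const_mul, ← mul_sub, abs_mul]
    simpa using hx n hn
  refine ⟨K + K', by positivity, fun n ↦ abs_le.2 ⟨?_, ?_⟩⟩
  · linarith [hK' n]
  · linarith [hK n]

/-! ### The recursion for the finitely supported laws -/

/-- The probability `indexProb n j k` as a real number. -/
noncomputable def stepWeight (n j k : ℕ) : ℝ := (indexProb n j k).toReal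

theorem stepWeight_nonneg (n j k : ℕ) : 0 ≤ stepWeight n j k := ENNReal.toReal_nonneg

theorem stepWeight_zero_zero (n : ℕ) : stepWeight n 0 0 = 1 / 2 ^ n := by
  simp [stepWeight, indexProb]

theorem stepWeight_zero_succ (n k : ℕ) : stepWeight n 0 (k + 1) = 0 := by
  simp [stepWeight, indexProb]

theorem stepWeight_succ (n j k : ℕ) :
    stepWeight n (j + 1) k = if j + k < n then ((n - k - 1).choose j : ℝ) / 2 ^ n else 0 := by
  unfold stepWeight indexProb
  rw [if_neg (by omega), Nat.add_sub_cancel]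
  by_cases h : j + k < n
  · rw [if_pos (by omega), if_pos h]; simp [div_eq_mul_inv]
  · rw [if_neg (by omega), if_neg h]; simp

/-- The size `I₁` of the first group is binomial. -/
theorem sum_stepWeight_right (n j : ℕ) :
    ∑ k ∈ Finset.range (n + 1), stepWeight n j k = (n.choose j : ℝ) / 2 ^ n := by
  rcases j with _ | j
  · rw [Finset.sum_range_succ']
    simp [stepWeight_zero_zero, stepWeight_zero_succ]
  · simp only [stepWeight_succ]
    have h1 : ∀ k ∈ Finset.range (n + 1), (if j + k < n then ((n - k - 1).choose j : ℝ) / 2 ^ n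
        else 0) = if k < n then ((n - 1 - k).choose j : ℝ) / 2 ^ n else 0 := by
      intro k _
      by_cases h : j + k < n
      · rw [if_pos h, if_pos (by omega), Nat.sub_right_comm]
      · rw [if_neg h]
        split_ifs
        · rw [Nat.choose_eq_zero_of_lt (by omega)]; simp
        · rfl
    rw [Finset.sum_congr rfl h1, Finset.sum_range_succ, if_neg (lt_irrefl _), add_zero,
      Finset.sum_congr rfl (fun k hk ↦ if_pos (Finset.mem_range.1 hk)), ← Finset.sum_div,
      Finset.sum_range_reflect (fun i ↦ (i.choose j : ℝ)) n]
    rw [← Nat.cast_sum]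
    congr 2
    clear h1
    induction n with
    | zero => simp
    | succ n ih => rw [Finset.sum_range_succ, ih, Nat.choose_succ_succ, add_comm]

/-- The size `I₂` of the second group is geometric, cut off at `n`. -/
theorem sum_stepWeight_left {n k : ℕ} (h1 : 1 ≤ k) (hk : k < n) :
    ∑ j ∈ Finset.range (n + 1), stepWeight n j k = (1 / 2) ^ (k + 1) := by
  obtain ⟨l, rfl⟩ : ∃ l, k = l + 1 := ⟨k - 1, by omega⟩
  obtain ⟨d, rfl⟩ : ∃ d, n = l + 1 + 1 + d := ⟨n - (l + 1 + 1), by omega⟩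
  rw [Finset.sum_range_succ', stepWeight_zero_succ, add_zero]
  simp only [stepWeight_succ]
  have hs := Finset.sum_subset (s₁ := Finset.range (d + 1)) (s₂ := Finset.range (l + 1 + 1 + d))
    (f := fun x ↦ if x + (l + 1) < l + 1 + 1 + d then
      ((l + 1 + 1 + d - (l + 1) - 1).choose x : ℝ) / 2 ^ (l + 1 + 1 + d) else 0)
    (fun x hx ↦ by simp only [Finset.mem_range] at *; omega)
    (fun x hx hx' ↦ if_neg (by simp only [Finset.mem_range] at *; omega))
  rw [← hs, Finset.sum_congr rfl (fun x hx ↦ if_pos (by simp only [Finset.mem_range] at hx; omega))]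
  have e : l + 1 + 1 + d - (l + 1) - 1 = d := by omega
  rw [e, ← Finset.sum_div, ← Nat.cast_sum, Nat.sum_range_choose, pow_add (2 : ℝ) (l + 1 + 1) d]
  push_cast
  rw [one_div_pow]
  field_simp

theorem stepWeight_self {n : ℕ} (hn : 1 ≤ n) (j : ℕ) : stepWeight n j n = 0 := by
  rcases j with _ | j
  · obtain ⟨m, rfl⟩ : ∃ m, n = m + 1 := ⟨n - 1, by omega⟩
    exact stepWeight_zero_succ _ _
  · rw [stepWeight_succ, if_neg (by omega)]

/-- The expectation of `f (Yₙ)` when `p n ℓ` is the probability of `Yₙ = ℓ`; the values of `Yₙ`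
are at most `n²`. -/
noncomputable def countE (p : ℕ → ℕ → ℝ) (n : ℕ) (f : ℕ → ℝ) : ℝ :=
  ∑ l ∈ Finset.range (n ^ 2 + 1), p n l * f l

/-- The expectation of `F (I₁, I₂, Y⁽²⁾_{I₂})` for an input of size `n`. -/
noncomputable def stepE (p : ℕ → ℕ → ℝ) (n : ℕ) (F : ℕ × ℕ × ℕ → ℝ) : ℝ :=
  ∑ j ∈ Finset.range (n + 1), ∑ k ∈ Finset.range (n + 1),
    stepWeight n j k * countE p k (fun b ↦ F (j, k, b))

/-- Weights `p n ℓ`, for `ℓ ≤ n²`, with the properties of the probabilities of `Yₙ = ℓ` for a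
sequence `Y` as in `IsComparisonCount`. The subtraction `n - i.1` is not truncated, since
`I₁ ≤ n`. -/
structure IsCountLaw (p : ℕ → ℕ → ℝ) : Prop where
  nonneg : ∀ n l, 0 ≤ p n l
  sum_eq_one : ∀ n, ∑ l ∈ Finset.range (n ^ 2 + 1), p n l = 1
  one : p 1 1 = 0
  recurrence : ∀ n, 2 ≤ n → ∀ f : ℕ → ℝ, countE p n f =
    stepE p n (fun i ↦ countE p i.1 (fun a ↦ f (a + i.2.2 + (n - i.1))))

/-- The mean of `Yₙ`. -/
noncomputable def countMean (p : ℕ → ℕ → ℝ) (n : ℕ) : ℝ := countE p n (fun a ↦ a)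

/-- The mean of `Yₙ - n`. -/
noncomputable def excess (p : ℕ → ℕ → ℝ) (n : ℕ) : ℝ := countMean p n - n

/-- The variance of `Yₙ`. -/
noncomputable def countVar (p : ℕ → ℕ → ℝ) (n : ℕ) : ℝ :=
  countE p n (fun a ↦ ((a : ℝ) - countMean p n) ^ 2)

/-- The increment `Y⁽²⁾_{I₂} + m_{I₁} - mₙ`, where `mₙ` is the mean of `Yₙ - n`. It turns the
centered first group into the centered whole. -/
noncomputable def increment (p : ℕ → ℕ → ℝ) (n : ℕ) (i : ℕ × ℕ × ℕ) : ℝ :=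
  excess p i.1 - excess p n + i.2.2

theorem exists_pow_mul_half_pow_le (q : ℕ) :
    ∃ L : ℝ, 0 ≤ L ∧ ∀ n : ℕ, ((n : ℝ) + 1) ^ q * (1 / 2) ^ (n + 1) ≤ L := by
  have h := (tendsto_pow_const_mul_const_pow_of_abs_lt_one q (r := 1 / 2)
    (by rw [abs_of_pos] <;> norm_num)).bddAbove_range
  obtain ⟨L, hL⟩ := h
  have h2 : ∀ n : ℕ, ((n : ℝ) + 1) ^ q * (1 / 2) ^ (n + 1) ≤ L := fun n ↦ by
    simpa using hL ⟨n + 1, rfl⟩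
  exact ⟨L, le_trans (by positivity) (h2 0), h2⟩

/-- Series with geometric weights and polynomially bounded terms converge, with an error that is
estimated by the telescoping majorant `L / (n + 1)`. -/
theorem exists_abs_sum_half_pow_sub_le {r : ℕ → ℝ} {q : ℕ} (h0 : ∀ k, 0 ≤ r k)
    (hr : ∀ k : ℕ, r k ≤ ((k : ℝ) + 1) ^ q) :
    ∃ S L : ℝ, 0 ≤ L ∧
      ∀ n : ℕ, |∑ k ∈ Finset.range n, (1 / 2) ^ (k + 1) * r k - S| ≤ L / (n + 1) := by
  obtain ⟨L, hL0, hL⟩ := exists_pow_mul_half_pow_le (q + 2)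
  set s : ℕ → ℝ := fun n ↦ ∑ k ∈ Finset.range n, (1 / 2) ^ (k + 1) * r k with hs
  have hmono : Monotone s := monotone_nat_of_le_succ fun n ↦ by
    rw [hs]
    simp only [Finset.sum_range_succ]
    have : 0 ≤ (1 / 2 : ℝ) ^ (n + 1) * r n := mul_nonneg (by positivity) (h0 n)
    linarith
  have hanti : Antitone fun n ↦ s n + 2 * L / ((n : ℝ) + 1) := antitone_nat_of_succ_le fun n ↦ by
    rw [hs]
    simp only [Finset.sum_range_succ]
    have h1 : (1 / 2 : ℝ) ^ (n + 1) * r n ≤ L / ((n : ℝ) + 1) ^ 2 := by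
      rw [le_div_iff₀ (by positivity)]
      calc (1 / 2 : ℝ) ^ (n + 1) * r n * ((n : ℝ) + 1) ^ 2
          ≤ (1 / 2 : ℝ) ^ (n + 1) * ((n : ℝ) + 1) ^ q * ((n : ℝ) + 1) ^ 2 := by
            gcongr
            exact hr n
        _ = ((n : ℝ) + 1) ^ (q + 2) * (1 / 2) ^ (n + 1) := by ring
        _ ≤ L := hL n
    have h2 : L / ((n : ℝ) + 1) ^ 2 ≤ 2 * L / ((n : ℝ) + 1) - 2 * L / ((n : ℝ) + 1 + 1) := by
      rw [div_sub_div _ _ (by positivity) (by positivity), div_le_div_iff₀ (by positivity)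
        (by positivity)]
      have hn : (0 : ℝ) ≤ n := Nat.cast_nonneg n
      have : 0 ≤ L * ((n : ℝ) + 1) * n := by positivity
      nlinarith
    push_cast
    linarith
  have hle : ∀ m n, s m ≤ s n + 2 * L / ((n : ℝ) + 1) := fun m n ↦ by
    rcases le_total m n with h | h
    · have : 0 ≤ 2 * L / ((n : ℝ) + 1) := by positivity
      linarith [hmono h]
    · have h1 := hanti h
      have : 0 ≤ 2 * L / ((m : ℝ) + 1) := by positivity
      simp only at h1
      linarith
  refine ⟨⨆ n, s n, 2 * L, by positivity, fun n ↦ ?_⟩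
  have hb : BddAbove (Set.range s) := ⟨_, by rintro _ ⟨m, rfl⟩; exact hle m 0⟩
  have h1 := le_ciSup hb n
  have h2 := ciSup_le fun m ↦ hle m n
  rw [abs_le]
  constructor
  · linarith
  · have : 0 ≤ 2 * L / ((n : ℝ) + 1) := by positivity
    linarith

namespace IsCountLaw

variable {p : ℕ → ℕ → ℝ}

theorem isMean_countE (hp : IsCountLaw p) (n : ℕ) : IsMean (countE p n) :=
  isMean_sum _ _ (fun l _ ↦ hp.nonneg n l) (hp.sum_eq_one n)

theorem countE_zero (hp : IsCountLaw p) (f : ℕ → ℝ) : countE p 0 f = f 0 := by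
  have := hp.sum_eq_one 0
  simp at this
  simp [countE, this]

theorem countE_one (hp : IsCountLaw p) (f : ℕ → ℝ) : countE p 1 f = f 0 := by
  have := hp.sum_eq_one 1
  simp [Finset.sum_range_succ, hp.one] at this
  simp [countE, this, Finset.sum_range_succ, hp.one]

theorem countE_mono (hp : IsCountLaw p) {n : ℕ} {f g : ℕ → ℝ} (h : ∀ l ≤ n ^ 2, f l ≤ g l) :
    countE p n f ≤ countE p n g :=
  Finset.sum_le_sum fun l hl ↦ mul_le_mul_of_nonneg_left
    (h l (Nat.lt_succ_iff.1 (Finset.mem_range.1 hl))) (hp.nonneg n l)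

theorem countE_pow_nonneg (hp : IsCountLaw p) (n q : ℕ) : 0 ≤ countE p n (fun b ↦ (b : ℝ) ^ q) :=
  (hp.isMean_countE n).nonneg fun _ ↦ by positivity

theorem countE_pow_le (hp : IsCountLaw p) (n q : ℕ) :
    countE p n (fun b ↦ (b : ℝ) ^ q) ≤ ((n : ℝ) + 1) ^ (2 * q) := by
  calc countE p n (fun b ↦ (b : ℝ) ^ q) ≤ countE p n (fun _ ↦ ((n : ℝ) + 1) ^ (2 * q)) := by
        refine hp.countE_mono fun l hl ↦ ?_
        have h1 : (l : ℝ) ≤ (n : ℝ) ^ 2 := by exact_mod_cast hl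
        rw [pow_mul]
        have h2 : (0 : ℝ) ≤ n := Nat.cast_nonneg n
        gcongr
        nlinarith
    _ = _ := (hp.isMean_countE n).const _

/-- The first group size is binomial. -/
theorem stepE_fst (hp : IsCountLaw p) (n : ℕ) (x : ℕ → ℝ) :
    stepE p n (fun i ↦ x i.1) = binE n x := by
  unfold stepE binE
  refine Finset.sum_congr rfl fun j _ ↦ ?_
  simp only [(hp.isMean_countE _).const]
  rw [← Finset.sum_mul, sum_stepWeight_right]

theorem isMean_stepE (hp : IsCountLaw p) (n : ℕ) : IsMean (stepE p n) where
  add f g := by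
    unfold stepE
    simp only [(hp.isMean_countE _).add, mul_add, Finset.sum_add_distrib]
  const_mul c f := by
    unfold stepE
    simp only [(hp.isMean_countE _).const_mul, Finset.mul_sum]
    exact Finset.sum_congr rfl fun _ _ ↦ Finset.sum_congr rfl fun _ _ ↦ by ring
  mono f g h := Finset.sum_le_sum fun j _ ↦ Finset.sum_le_sum fun k _ ↦
    mul_le_mul_of_nonneg_left ((hp.isMean_countE k).mono _ _ fun b ↦ h _) (stepWeight_nonneg _ _ _)
  const c := by
    rw [hp.stepE_fst n fun _ ↦ c]
    exact (isMean_binE n).const c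

/-- The second group size is geometric, cut off at `n`; the term `k = 0` vanishes. -/
theorem stepE_snd (hp : IsCountLaw p) {n : ℕ} (hn : 1 ≤ n) {g : ℕ → ℝ} (hg : g 0 = 0) :
    stepE p n (fun i ↦ g i.2.2) = ∑ k ∈ Finset.range n, (1 / 2) ^ (k + 1) * countE p k g := by
  unfold stepE
  rw [Finset.sum_comm, Finset.sum_range_succ]
  have h0 : ∑ j ∈ Finset.range (n + 1), stepWeight n j n * countE p n g = 0 :=
    Finset.sum_eq_zero fun j _ ↦ by rw [stepWeight_self hn, zero_mul]
  rw [h0, add_zero]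
  refine Finset.sum_congr rfl fun k hk ↦ ?_
  simp only
  rw [← Finset.sum_mul]
  rcases Nat.eq_zero_or_pos k with rfl | h
  · simp [hp.countE_zero, hg]
  · rw [sum_stepWeight_left h (Finset.mem_range.1 hk)]

theorem stepWeight_mul_le_stepE (hp : IsCountLaw p) {n j k : ℕ} (hj : j ≤ n) (hk : k ≤ n)
    {F : ℕ × ℕ × ℕ → ℝ} (hF : ∀ i, 0 ≤ F i) :
    stepWeight n j k * countE p k (fun b ↦ F (j, k, b)) ≤ stepE p n F := by
  have h0 : ∀ j k, 0 ≤ stepWeight n j k * countE p k (fun b ↦ F (j, k, b)) := fun j k ↦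
    mul_nonneg (stepWeight_nonneg _ _ _) ((hp.isMean_countE k).nonneg fun b ↦ hF _)
  refine (Finset.single_le_sum (f := fun k ↦ stepWeight n j k * countE p k (fun b ↦ F (j, k, b)))
    (fun k _ ↦ h0 j k) (Finset.mem_range.2 (Nat.lt_succ_iff.2 hk))).trans ?_
  exact Finset.single_le_sum (f := fun j ↦ ∑ k ∈ Finset.range (n + 1),
    stepWeight n j k * countE p k (fun b ↦ F (j, k, b)))
    (fun j _ ↦ Finset.sum_nonneg fun k _ ↦ h0 j k) (Finset.mem_range.2 (Nat.lt_succ_iff.2 hj))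

theorem stepE_congr {n : ℕ} {F G : ℕ × ℕ × ℕ → ℝ}
    (h : ∀ i : ℕ × ℕ × ℕ, i.1 ≤ n → F i = G i) : stepE p n F = stepE p n G := by
  refine Finset.sum_congr rfl fun j hj ↦ Finset.sum_congr rfl fun k _ ↦ ?_
  congr 2
  funext b
  exact h _ (Nat.lt_succ_iff.1 (Finset.mem_range.1 hj))

/-- The recursion for the centered variables. -/
theorem countE_centered (hp : IsCountLaw p) {n : ℕ} (hn : 2 ≤ n) (f : ℝ → ℝ) :
    countE p n (fun a ↦ f (a - countMean p n)) = stepE p n (fun i ↦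
      countE p i.1 (fun a ↦ f (a - countMean p i.1 + increment p n i))) := by
  rw [hp.recurrence n hn]
  refine stepE_congr fun i hi ↦ ?_
  congr 1
  funext a
  congr 1
  push_cast [Nat.cast_sub hi]
  unfold increment excess
  ring

/-! ### The mean -/

theorem excess_zero (hp : IsCountLaw p) : excess p 0 = 0 := by
  simp [excess, countMean, hp.countE_zero]

theorem excess_one (hp : IsCountLaw p) : excess p 1 = -1 := by
  simp [excess, countMean, hp.countE_one]

theorem countE_sub_mean (hp : IsCountLaw p) (n : ℕ) :
    countE p n (fun a ↦ (a : ℝ) - countMean p n) = 0 := by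
  rw [(hp.isMean_countE n).sub_const]; exact sub_self _

theorem stepE_increment (hp : IsCountLaw p) {n : ℕ} (hn : 2 ≤ n) :
    stepE p n (increment p n) = 0 := by
  have h := hp.countE_centered hn (fun x ↦ x)
  simp only [(hp.isMean_countE _).add_const, hp.countE_sub_mean, zero_add] at h
  exact h.symm

theorem excess_eq (hp : IsCountLaw p) {n : ℕ} (hn : 2 ≤ n) :
    excess p n = binE n (excess p) + stepE p n (fun i ↦ i.2.2) := by
  have h := hp.stepE_increment hn
  unfold increment at h
  rw [(hp.isMean_stepE n).add, (hp.isMean_stepE n).sub_const, hp.stepE_fst] at h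
  linarith

/-- The mean of `Yₙ - n` varies like a logarithm: after size biasing, its rescaled differences
`n (mₙ - mₙ₋₁)` satisfy the same recursion as `mₙ`, with an exponentially small inhomogeneity. -/
theorem exists_abs_excess_succ_sub_le (hp : IsCountLaw p) :
    ∃ K, 0 ≤ K ∧ ∀ n : ℕ, |excess p (n + 1) - excess p n| ≤ K / (n + 1) := by
  obtain ⟨L, hL0, hL⟩ := exists_pow_mul_half_pow_le 4
  set x : ℕ → ℝ := fun n ↦ n * (excess p n - excess p (n - 1)) with hxdef
  obtain ⟨K, hK0, hK⟩ := exists_abs_le_of_abs_sub_binE_le (x := x) (L := 2 * L) (n₀ := 3)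
    (by norm_num) fun n hn ↦ by
      obtain ⟨m, rfl⟩ : ∃ m, n = m + 1 := ⟨n - 1, by omega⟩
      have h1 := hp.excess_eq (n := m + 1) (by omega)
      have h2 := hp.excess_eq (n := m) (by omega)
      have h3 := binE_succ m (excess p)
      have h4 : binE m (fun j ↦ excess p (j + 1)) - binE m (excess p)
          = 2 / (m + 1) * binE (m + 1) x := by
        have := binE_div_succ m x
        rw [← (isMean_binE m).sub]
        have hx : (fun j : ℕ ↦ x (j + 1) / ((j : ℝ) + 1))
            = fun j ↦ excess p (j + 1) - excess p j := by
          funext j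
          simp only [hxdef, Nat.add_sub_cancel]
          push_cast
          field_simp
        rw [hx] at this
        rw [this]
        simp [hxdef]
      have h5 : stepE p (m + 1) (fun i ↦ (i.2.2 : ℝ)) - stepE p m (fun i ↦ (i.2.2 : ℝ))
          = (1 / 2) ^ (m + 1) * countMean p m := by
        rw [hp.stepE_snd (n := m + 1) (by omega) (g := fun b ↦ (b : ℝ)) (by simp),
          hp.stepE_snd (n := m) (by omega) (g := fun b ↦ (b : ℝ)) (by simp),
          Finset.sum_range_succ, countMean]
        ring
      have h6 : x (m + 1) - binE (m + 1) x = (m + 1) * ((1 / 2) ^ (m + 1) * countMean p m) := by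
        have h7 : x (m + 1) = (m + 1) * (excess p (m + 1) - excess p m) := by
          simp [hxdef]
        have h8 : excess p (m + 1) - excess p m
            = 1 / (m + 1) * binE (m + 1) x + (1 / 2) ^ (m + 1) * countMean p m := by
          rw [← h5, h1, h2, h3]
          have : 1 / ((m : ℝ) + 1) * binE (m + 1) x = (2 / (m + 1) * binE (m + 1) x) / 2 := by ring
          rw [this, ← h4]
          ring
        rw [h7, h8]
        field_simp
        ring
      have h9 : 0 ≤ countMean p m := by simpa [countMean] using hp.countE_pow_nonneg m 1
      have h10 : countMean p m ≤ ((m : ℝ) + 1) ^ 2 := by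
        simpa [countMean] using hp.countE_pow_le m 1
      rw [h6, abs_of_nonneg (by positivity), le_div_iff₀ (Real.sqrt_pos.2 (by positivity))]
      have h11 : √(((m + 1 : ℕ) : ℝ) + 1) ≤ 2 * (m + 1) := by
        rw [Real.sqrt_le_left (by positivity)]
        push_cast
        nlinarith [(Nat.cast_nonneg m : (0 : ℝ) ≤ m)]
      calc ((m : ℝ) + 1) * ((1 / 2) ^ (m + 1) * countMean p m) * √(((m + 1 : ℕ) : ℝ) + 1)
          ≤ ((m : ℝ) + 1) * ((1 / 2) ^ (m + 1) * ((m : ℝ) + 1) ^ 2) * (2 * (m + 1)) := by gcongr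
        _ = 2 * (((m : ℝ) + 1) ^ 4 * (1 / 2) ^ (m + 1)) := by ring
        _ ≤ 2 * L := by gcongr; exact hL m
  refine ⟨K, hK0, fun n ↦ ?_⟩
  have := hK (n + 1)
  simp only [hxdef, Nat.add_sub_cancel] at this
  rw [abs_mul, abs_of_nonneg (by positivity)] at this
  rw [le_div_iff₀ (by positivity)]
  push_cast at this
  linarith

end IsCountLaw

theorem abs_sub_le_mul_abs_harmonic_sub {x : ℕ → ℝ} {K : ℝ}
    (hx : ∀ n : ℕ, |x (n + 1) - x n| ≤ K / (n + 1)) (i j : ℕ) :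
    |x i - x j| ≤ K * |(harmonic i : ℝ) - harmonic j| := by
  have key : ∀ d j, |x (j + d) - x j| ≤ K * ((harmonic (j + d) : ℝ) - harmonic j) := by
    intro d j
    induction d with
    | zero => simp
    | succ d ih =>
      have h1 := hx (j + d)
      have h2 := harmonic_cast_succ (j + d)
      rw [← add_assoc, h2]
      have h3 := abs_sub_le (x (j + d + 1)) (x (j + d)) (x j)
      have h4 : K / (((j + d : ℕ) : ℝ) + 1) = K * (1 / (((j + d : ℕ) : ℝ) + 1)) := by ring
      rw [h4] at h1
      linarith
  rcases le_total j i with h | h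
  · obtain ⟨d, rfl⟩ := Nat.exists_eq_add_of_le h
    rw [abs_of_nonneg (sub_nonneg.2 (harmonic_mono h))]
    exact key d j
  · obtain ⟨d, rfl⟩ := Nat.exists_eq_add_of_le h
    rw [abs_sub_comm, abs_sub_comm (harmonic i : ℝ), abs_of_nonneg (sub_nonneg.2 (harmonic_mono h))]
    exact key d i

theorem binE_sq_sub_mean_le_of_abs_le {x : ℕ → ℝ} {K : ℝ}
    (hx : ∀ n : ℕ, |x (n + 1) - x n| ≤ K / (n + 1)) {n : ℕ} (hn : 1 ≤ n) :
    binE n (fun j ↦ (x j - binE n x) ^ 2) ≤ 2 * K ^ 2 / (n + 1) := by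
  obtain ⟨m, rfl⟩ : ∃ m, n = m + 1 := ⟨n - 1, by omega⟩
  refine (binE_sq_sub_mean_le m x).trans ?_
  have h1 : binE m (fun j ↦ (x (j + 1) - x j) ^ 2) ≤ K ^ 2 * (8 / ((m + 1) * (m + 2))) := by
    refine le_trans ?_ (mul_le_mul_of_nonneg_left (binE_one_div_sq_le m) (sq_nonneg K))
    rw [← (isMean_binE m).const_mul]
    refine (isMean_binE m).mono _ _ fun j ↦ ?_
    rw [← mul_pow, mul_one_div, ← sq_abs]
    gcongr
    exact hx j
  calc ((m : ℝ) + 1) / 4 * binE m (fun j ↦ (x (j + 1) - x j) ^ 2)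
      ≤ ((m : ℝ) + 1) / 4 * (K ^ 2 * (8 / ((m + 1) * (m + 2)))) := by gcongr
    _ = _ := by push_cast; field_simp; ring

/-! ### The variance -/

/-- The second moment of the increment: the inhomogeneity in the recursion for the variance. -/
noncomputable def incrementVar (p : ℕ → ℕ → ℝ) (n : ℕ) : ℝ :=
  stepE p n (fun i ↦ increment p n i ^ 2)

namespace IsCountLaw

variable {p : ℕ → ℕ → ℝ}

theorem countVar_nonneg (hp : IsCountLaw p) (n : ℕ) : 0 ≤ countVar p n :=
  (hp.isMean_countE n).nonneg fun _ ↦ sq_nonneg _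

theorem countVar_zero (hp : IsCountLaw p) : countVar p 0 = 0 := by
  simp [countVar, countMean, hp.countE_zero]

theorem countVar_one (hp : IsCountLaw p) : countVar p 1 = 0 := by
  simp [countVar, countMean, hp.countE_one]

theorem countVar_eq (hp : IsCountLaw p) {n : ℕ} (hn : 2 ≤ n) :
    countVar p n = binE n (countVar p) + incrementVar p n := by
  have h := hp.countE_centered hn (fun x ↦ x ^ 2)
  have h2 : ∀ i : ℕ × ℕ × ℕ,
      countE p i.1 (fun a ↦ ((a : ℝ) - countMean p i.1 + increment p n i) ^ 2)
        = countVar p i.1 + increment p n i ^ 2 := fun i ↦ by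
    have e : (fun a : ℕ ↦ ((a : ℝ) - countMean p i.1 + increment p n i) ^ 2)
        = fun a : ℕ ↦ ((a : ℝ) - countMean p i.1) ^ 2
          + (2 * increment p n i) * ((a : ℝ) - countMean p i.1) + increment p n i ^ 2 := by
      funext a; ring
    rw [e, (hp.isMean_countE _).add_const, (hp.isMean_countE _).add,
      (hp.isMean_countE _).const_mul, hp.countE_sub_mean, mul_zero, add_zero]
    rfl
  simp only [h2] at h
  rw [(hp.isMean_stepE n).add, hp.stepE_fst] at h
  exact h

/-- If the second group is empty, the increment takes at least the two values `-mₙ` and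
`-1 - mₙ`. -/
theorem countVar_pos (hp : IsCountLaw p) {n : ℕ} (hn : 2 ≤ n) : 0 < countVar p n := by
  have h0 : 0 ≤ binE n (countVar p) := (isMean_binE n).nonneg hp.countVar_nonneg
  rw [hp.countVar_eq hn]
  have h1 := hp.stepWeight_mul_le_stepE (n := n) (j := 0) (k := 0) (by omega) (by omega)
    (F := fun i ↦ increment p n i ^ 2) fun _ ↦ sq_nonneg _
  have h2 := hp.stepWeight_mul_le_stepE (n := n) (j := 1) (k := 0) (by omega) (by omega)
    (F := fun i ↦ increment p n i ^ 2) fun _ ↦ sq_nonneg _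
  have hw : stepWeight n 1 0 = 1 / 2 ^ n := by
    have := stepWeight_succ n 0 0
    rw [if_pos (by omega)] at this
    simpa using this
  rw [stepWeight_zero_zero, hp.countE_zero] at h1
  rw [hw, hp.countE_zero] at h2
  simp only [increment, hp.excess_zero, hp.excess_one, Nat.cast_zero, add_zero] at h1 h2
  change _ ≤ incrementVar p n at h1
  change _ ≤ incrementVar p n at h2
  have h3 : (0 : ℝ) < 1 / 2 ^ n := by positivity
  nlinarith [sq_nonneg (2 * excess p n + 1)]

/-- The moments of the second summand `Y⁽²⁾_{I₂}` converge with rate `1 / n`. -/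
theorem exists_abs_stepE_snd_pow_sub_le (hp : IsCountLaw p) {q : ℕ} (hq : q ≠ 0) :
    ∃ S L : ℝ, 0 ≤ L ∧ ∀ n : ℕ, 1 ≤ n →
      |stepE p n (fun i ↦ (i.2.2 : ℝ) ^ q) - S| ≤ L / (n + 1) := by
  obtain ⟨S, L, hL, h⟩ := exists_abs_sum_half_pow_sub_le (fun k ↦ hp.countE_pow_nonneg k q)
    fun k ↦ hp.countE_pow_le k q
  refine ⟨S, L, hL, fun n hn ↦ ?_⟩
  rw [hp.stepE_snd hn (g := fun b ↦ (b : ℝ) ^ q) (by simp [hq])]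
  exact h n

theorem stepE_pow_nonneg (hp : IsCountLaw p) (n q : ℕ) :
    0 ≤ stepE p n (fun i ↦ (i.2.2 : ℝ) ^ q) :=
  (hp.isMean_stepE n).nonneg fun _ ↦ by positivity

theorem exists_stepE_snd_pow_le (hp : IsCountLaw p) {q : ℕ} (hq : q ≠ 0) :
    ∃ S : ℝ, 0 ≤ S ∧ ∀ n : ℕ, 1 ≤ n → stepE p n (fun i ↦ (i.2.2 : ℝ) ^ q) ≤ S := by
  obtain ⟨S, L, hL, h⟩ := hp.exists_abs_stepE_snd_pow_sub_le hq
  have h1 : ∀ n : ℕ, 1 ≤ n → stepE p n (fun i ↦ (i.2.2 : ℝ) ^ q) ≤ S + L := fun n hn ↦ by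
    have h2 : L / ((n : ℝ) + 1) ≤ L :=
      div_le_self hL (by linarith [(Nat.cast_nonneg n : (0 : ℝ) ≤ n)])
    linarith [(abs_le.1 (h n hn)).2]
  exact ⟨S + L, (hp.stepE_pow_nonneg 1 q).trans (h1 1 le_rfl), h1⟩

/-- The variance of the second summand `Y⁽²⁾_{I₂}`. -/
theorem stepE_sq_sub (hp : IsCountLaw p) (n : ℕ) :
    stepE p n (fun i ↦ ((i.2.2 : ℝ) - stepE p n (fun i ↦ (i.2.2 : ℝ) ^ 1)) ^ 2)
      = stepE p n (fun i ↦ (i.2.2 : ℝ) ^ 2) - stepE p n (fun i ↦ (i.2.2 : ℝ) ^ 1) ^ 2 := by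
  simp only [pow_one]
  exact (hp.isMean_stepE n).sq_sub_mean _

theorem sum_half_pow (n : ℕ) : ∑ k ∈ Finset.range n, (1 / 2 : ℝ) ^ (k + 1) = 1 - (1 / 2) ^ n := by
  induction n with
  | zero => simp
  | succ n ih => rw [Finset.sum_range_succ, ih]; ring

/-- The second summand is not degenerate, since `I₂ = 2` has probability `1/8`. -/
theorem countVar_two_le (hp : IsCountLaw p) {n : ℕ} (hn : 3 ≤ n) (c : ℝ) :
    countVar p 2 / 8 ≤ stepE p n (fun i ↦ ((i.2.2 : ℝ) - c) ^ 2) := by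
  have h1 := hp.stepE_snd (n := n) (by omega) (g := fun b ↦ ((b : ℝ) - c) ^ 2 - c ^ 2) (by simp)
  rw [(hp.isMean_stepE n).sub_const] at h1
  simp only [(hp.isMean_countE _).sub_const, mul_sub, Finset.sum_sub_distrib,
    ← Finset.sum_mul] at h1
  rw [sum_half_pow] at h1
  have h2 := Finset.single_le_sum (f := fun k ↦ (1 / 2 : ℝ) ^ (k + 1) *
      countE p k (fun b ↦ ((b : ℝ) - c) ^ 2))
    (fun k _ ↦ mul_nonneg (by positivity) ((hp.isMean_countE k).nonneg fun _ ↦ sq_nonneg _))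
    (Finset.mem_range.2 (show 2 < n by omega))
  have h3 : countVar p 2 ≤ countE p 2 (fun b ↦ ((b : ℝ) - c) ^ 2) :=
    (hp.isMean_countE 2).sq_sub_mean_le _ c
  have h4 : 0 ≤ (1 / 2 : ℝ) ^ n * c ^ 2 := by positivity
  norm_num at h2
  linarith

/-- The variance of the increment converges to a positive limit, the variance of `Y_G` for a
geometric variable `G`: the other contribution to the increment, `m_{I₁} - 𝔼 m_{I₁}`, has variance
`O(1 / n)` by the Efron–Stein inequality. -/
theorem exists_abs_incrementVar_sub_le (hp : IsCountLaw p) :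
    ∃ τ L : ℝ, 0 < τ ∧ ∀ n : ℕ, 3 ≤ n → |incrementVar p n - τ| ≤ L / √((n : ℝ) + 1) := by
  obtain ⟨S₁, L₁, hL₁, h₁⟩ := hp.exists_abs_stepE_snd_pow_sub_le one_ne_zero
  obtain ⟨S₂, L₂, hL₂, h₂⟩ := hp.exists_abs_stepE_snd_pow_sub_le two_ne_zero
  obtain ⟨T₁, hT₁, hb₁⟩ := hp.exists_stepE_snd_pow_le one_ne_zero
  obtain ⟨T₂, hT₂, hb₂⟩ := hp.exists_stepE_snd_pow_le two_ne_zero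
  obtain ⟨K, hK0, hK⟩ := hp.exists_abs_excess_succ_sub_le
  set q₁ : ℕ → ℝ := fun n ↦ stepE p n (fun i ↦ (i.2.2 : ℝ) ^ 1) with hq₁
  set q₂ : ℕ → ℝ := fun n ↦ stepE p n (fun i ↦ (i.2.2 : ℝ) ^ 2) with hq₂
  have hq₁0 : ∀ n, 0 ≤ q₁ n := fun n ↦ hp.stepE_pow_nonneg n 1
  -- the variance of the second summand converges
  have hA : ∀ n : ℕ, 1 ≤ n →
      |(q₂ n - q₁ n ^ 2) - (S₂ - S₁ ^ 2)| ≤ (L₂ + L₁ * (T₁ + |S₁|)) / (n + 1) := fun n hn ↦ by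
    have e : (q₂ n - q₁ n ^ 2) - (S₂ - S₁ ^ 2) = (q₂ n - S₂) - (q₁ n - S₁) * (q₁ n + S₁) := by ring
    rw [e, add_div, mul_div_right_comm]
    refine (abs_sub _ _).trans (add_le_add (h₂ n hn) ?_)
    rw [abs_mul]
    refine mul_le_mul (h₁ n hn) ((abs_add_le _ _).trans ?_) (abs_nonneg _) (by positivity)
    rw [abs_of_nonneg (hq₁0 n)]
    linarith [hb₁ n hn]
  -- the error made by dropping the other contribution
  have hB : ∀ n : ℕ, 2 ≤ n →
      |incrementVar p n - (q₂ n - q₁ n ^ 2)| ≤ (T₂ + 4 * K ^ 2) / √((n : ℝ) + 1) := fun n hn ↦ by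
    set s := √((n : ℝ) + 1) with hs
    have hsp : 1 ≤ s := by
      rw [hs, Real.one_le_sqrt]; linarith [(Nat.cast_nonneg n : (0 : ℝ) ≤ n)]
    have hss : s ^ 2 = n + 1 := Real.sq_sqrt (by positivity)
    set M := binE n (excess p) with hM
    have hinc : ∀ i : ℕ × ℕ × ℕ,
        increment p n i = ((i.2.2 : ℝ) - q₁ n) + (excess p i.1 - M) := fun i ↦ by
      have := hp.excess_eq hn
      simp only [hq₁, pow_one, increment, hM]
      linarith
    have hV := binE_sq_sub_mean_le_of_abs_le hK (n := n) (by omega)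
    rw [← hM, ← hss, ← hp.stepE_fst n (fun j ↦ (excess p j - M) ^ 2)] at hV
    have hW : stepE p n (fun i ↦ ((i.2.2 : ℝ) - q₁ n) ^ 2) ≤ T₂ := by
      rw [hp.stepE_sq_sub n]
      linarith [hb₂ n (by omega), sq_nonneg (q₁ n)]
    have hW' := hp.stepE_sq_sub n
    have e1 : incrementVar p n - (q₂ n - q₁ n ^ 2) = stepE p n (fun i ↦
        2 * ((i.2.2 : ℝ) - q₁ n) * (excess p i.1 - M) + (excess p i.1 - M) ^ 2) := by
      rw [hq₂, hq₁]
      simp only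
      rw [← hW', incrementVar, ← (hp.isMean_stepE n).sub]
      congr 1
      funext i
      rw [hinc]
      simp only [hq₁]
      ring
    rw [e1]
    refine ((hp.isMean_stepE n).abs_le _).trans ?_
    calc _ ≤ stepE p n (fun i ↦ (1 / s) * ((i.2.2 : ℝ) - q₁ n) ^ 2
            + (s + 1) * (excess p i.1 - M) ^ 2) := by
          refine (hp.isMean_stepE n).mono _ _ fun i ↦ ?_
          generalize (i.2.2 : ℝ) - q₁ n = a
          generalize excess p i.1 - M = b
          have hs0 : 0 < s := by linarith
          have h1 : |2 * a * b| ≤ (1 / s) * a ^ 2 + s * b ^ 2 := by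
            have h3 : (1 / s) * a ^ 2 + s * b ^ 2 - 2 * a * b = (a - s * b) ^ 2 / s := by
              field_simp; ring
            have h4 : (1 / s) * a ^ 2 + s * b ^ 2 + 2 * a * b = (a + s * b) ^ 2 / s := by
              field_simp; ring
            have h5 : 0 ≤ (a - s * b) ^ 2 / s := by positivity
            have h6 : 0 ≤ (a + s * b) ^ 2 / s := by positivity
            rw [abs_le]
            constructor <;> linarith
          have h2 := abs_add_le (2 * a * b) (b ^ 2)
          rw [abs_of_nonneg (sq_nonneg b)] at h2
          linarith
      _ = (1 / s) * stepE p n (fun i ↦ ((i.2.2 : ℝ) - q₁ n) ^ 2)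
            + (s + 1) * stepE p n (fun i ↦ (excess p i.1 - M) ^ 2) := by
          rw [(hp.isMean_stepE n).add, (hp.isMean_stepE n).const_mul,
            (hp.isMean_stepE n).const_mul]
      _ ≤ (1 / s) * T₂ + (2 * s) * (2 * K ^ 2 / s ^ 2) := by
          have h0 : 0 ≤ stepE p n (fun i ↦ (excess p i.1 - M) ^ 2) :=
            (hp.isMean_stepE n).nonneg fun _ ↦ sq_nonneg _
          gcongr
          linarith
      _ = _ := by field_simp; ring
  have hτ : 0 < S₂ - S₁ ^ 2 := by
    have hv := hp.countVar_pos (n := 2) le_rfl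
    have hlim : Tendsto (fun n : ℕ ↦ q₂ n - q₁ n ^ 2) atTop (nhds (S₂ - S₁ ^ 2)) := by
      rw [tendsto_iff_norm_sub_tendsto_zero]
      refine squeeze_zero' (Eventually.of_forall fun _ ↦ norm_nonneg _)
        (eventually_atTop.2 ⟨1, fun n hn ↦ hA n hn⟩) ?_
      exact tendsto_const_nhds.div_atTop
        (tendsto_atTop_add_const_right _ _ tendsto_natCast_atTop_atTop)
    have : countVar p 2 / 8 ≤ S₂ - S₁ ^ 2 := by
      refine ge_of_tendsto hlim (eventually_atTop.2 ⟨3, fun n hn ↦ ?_⟩)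
      have := hp.stepE_sq_sub n
      simp only [hq₁, hq₂]
      rw [← this]
      exact hp.countVar_two_le hn _
    linarith
  refine ⟨S₂ - S₁ ^ 2, (T₂ + 4 * K ^ 2) + (L₂ + L₁ * (T₁ + |S₁|)), hτ, fun n hn ↦ ?_⟩
  have h1 := hA n (by omega)
  have h2 := hB n (by omega)
  have h3 : (L₂ + L₁ * (T₁ + |S₁|)) / ((n : ℝ) + 1)
      ≤ (L₂ + L₁ * (T₁ + |S₁|)) / √((n : ℝ) + 1) := by
    have : 0 ≤ L₂ + L₁ * (T₁ + |S₁|) := by positivity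
    refine div_le_div_of_nonneg_left this (Real.sqrt_pos.2 (by positivity)) ?_
    rw [Real.sqrt_le_left (by positivity)]
    nlinarith [(Nat.cast_nonneg n : (0 : ℝ) ≤ n)]
  rw [add_div]
  have h4 := abs_add_le (incrementVar p n - (q₂ n - q₁ n ^ 2)) ((q₂ n - q₁ n ^ 2) - (S₂ - S₁ ^ 2))
  rw [sub_add_sub_cancel] at h4
  linarith

/-- The variance grows like a harmonic number, up to a bounded error. -/
theorem exists_abs_countVar_sub_le (hp : IsCountLaw p) :
    ∃ s K : ℝ, 0 < s ∧ 0 ≤ K ∧ ∀ n : ℕ, |countVar p n - s * (harmonic n : ℝ)| ≤ K := by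
  obtain ⟨τ, L, hτ, h⟩ := hp.exists_abs_incrementVar_sub_le
  obtain ⟨L₂, hL₂0, hL₂⟩ := exists_pow_mul_half_pow_le 1
  have hl : 0 < Real.log 2 := Real.log_pos (by norm_num)
  set s := τ / Real.log 2 with hs
  have hsp : 0 < s := by positivity
  obtain ⟨K, hK0, hK⟩ := exists_abs_le_of_abs_sub_binE_le
    (x := fun n ↦ countVar p n - s * (harmonic n : ℝ)) (L := L + s * (2 * L₂)) (n₀ := 3)
    (by norm_num) fun n hn ↦ by
      rw [(isMean_binE n).sub, (isMean_binE n).const_mul, binE_harmonic, hp.countVar_eq (by omega)]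
      have e : binE n (countVar p) + incrementVar p n - s * (harmonic n : ℝ)
          - (binE n (countVar p) - s * ((harmonic n : ℝ) - harmonicGap n))
          = (incrementVar p n - τ) + -(s * (harmonicGap n - Real.log 2)) := by
        have : τ = s * Real.log 2 := by rw [hs]; field_simp
        rw [this]; ring
      rw [e, add_div]
      refine (abs_add_le _ _).trans (add_le_add (h n hn) ?_)
      rw [abs_neg, abs_mul, abs_of_pos hsp, mul_div_assoc]
      refine mul_le_mul_of_nonneg_left ((abs_harmonicGap_sub_le n).trans ?_) hsp.le
      rw [le_div_iff₀ (Real.sqrt_pos.2 (by positivity))]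
      have h2 : √((n : ℝ) + 1) ≤ n + 1 := by
        rw [Real.sqrt_le_left (by positivity)]
        nlinarith [(Nat.cast_nonneg n : (0 : ℝ) ≤ n)]
      have h3 := hL₂ n
      rw [pow_one, pow_succ] at h3
      have h4 : (0 : ℝ) < (1 / 2) ^ n := by positivity
      nlinarith
  exact ⟨s, K, hsp, hK0, hK⟩

/-- The third absolute moment of the increment is bounded. -/
theorem exists_stepE_abs_increment_pow_three_le (hp : IsCountLaw p) :
    ∃ C : ℝ, ∀ n : ℕ, 1 ≤ n → stepE p n (fun i ↦ |increment p n i| ^ 3) ≤ C := by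
  obtain ⟨K, hK0, hK⟩ := hp.exists_abs_excess_succ_sub_le
  obtain ⟨T, hT0, hT⟩ := hp.exists_stepE_snd_pow_le three_ne_zero
  refine ⟨4 * (K ^ 3 * (12 * Real.exp 1) + T), fun n hn ↦ ?_⟩
  have h1 : stepE p n (fun i ↦ |increment p n i| ^ 3) ≤ stepE p n (fun i ↦
      4 * (K ^ 3 * |(harmonic n : ℝ) - harmonic i.1| ^ 3 + (i.2.2 : ℝ) ^ 3)) := by
    refine (hp.isMean_stepE n).mono _ _ fun i ↦ ?_
    have h2 : |increment p n i| ≤ K * |(harmonic n : ℝ) - harmonic i.1| + i.2.2 := by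
      refine (abs_add_le _ _).trans ?_
      rw [abs_of_nonneg (Nat.cast_nonneg i.2.2 : (0 : ℝ) ≤ i.2.2), abs_sub_comm (harmonic n : ℝ)]
      gcongr
      exact abs_sub_le_mul_abs_harmonic_sub hK _ _
    rw [← mul_pow]
    have hu : 0 ≤ K * |(harmonic n : ℝ) - harmonic i.1| := by positivity
    have hv : (0 : ℝ) ≤ i.2.2 := Nat.cast_nonneg _
    generalize K * |(harmonic n : ℝ) - harmonic i.1| = u at *
    generalize (i.2.2 : ℝ) = v at *
    calc |increment p n i| ^ 3 ≤ (u + v) ^ 3 := by gcongr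
      _ ≤ 4 * (u ^ 3 + v ^ 3) := by nlinarith [mul_nonneg (add_nonneg hu hv) (sq_nonneg (u - v))]
  refine h1.trans ?_
  rw [(hp.isMean_stepE n).const_mul, (hp.isMean_stepE n).add, (hp.isMean_stepE n).const_mul,
    hp.stepE_fst n (fun j ↦ |(harmonic n : ℝ) - harmonic j| ^ 3)]
  have h3 : binE n (fun j ↦ |(harmonic n : ℝ) - harmonic j| ^ 3) ≤ 12 * Real.exp 1 := by
    refine le_trans (binE_mono fun j hj ↦ ?_) (binE_harmonic_sub_pow_three_le n)
    rw [abs_of_nonneg (sub_nonneg.2 (harmonic_mono hj))]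
  have h4 := hT n hn
  gcongr

/-- The conditional variance of the first group, `v_{I₁}`, has bounded variance. -/
theorem exists_binE_countVar_sq_sub_le (hp : IsCountLaw p) :
    ∃ C : ℝ, ∀ n : ℕ, 1 ≤ n →
      binE n (fun j ↦ (countVar p j - binE n (countVar p)) ^ 2) ≤ C := by
  obtain ⟨s, K, hs, hK0, hK⟩ := hp.exists_abs_countVar_sub_le
  refine ⟨2 * (s ^ 2 * 2) + 2 * K ^ 2, fun n hn ↦ ?_⟩
  set M := binE n (fun j ↦ (harmonic j : ℝ)) with hM
  have h1 : binE n (fun j ↦ ((harmonic j : ℝ) - M) ^ 2) ≤ 2 := by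
    refine (binE_sq_sub_mean_le_of_abs_le (K := 1) (fun j ↦ ?_) hn).trans ?_
    · rw [harmonic_cast_succ, add_sub_cancel_left, abs_of_nonneg (by positivity)]
    · rw [one_pow, mul_one]
      exact div_le_self (by norm_num) (by linarith [(Nat.cast_nonneg n : (0 : ℝ) ≤ n)])
  refine ((isMean_binE n).sq_sub_mean_le _ (s * M)).trans ?_
  calc _ ≤ binE n (fun j ↦ 2 * (s ^ 2 * ((harmonic j : ℝ) - M) ^ 2) + 2 * K ^ 2) := by
        refine (isMean_binE n).mono _ _ fun j ↦ ?_
        have h2 : (countVar p j - s * (harmonic j : ℝ)) ^ 2 ≤ K ^ 2 :=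
          sq_le_sq' (abs_le.1 (hK j)).1 (abs_le.1 (hK j)).2
        nlinarith [sq_nonneg ((countVar p j - s * (harmonic j : ℝ)) - s * ((harmonic j : ℝ) - M))]
    _ = 2 * (s ^ 2 * binE n (fun j ↦ ((harmonic j : ℝ) - M) ^ 2)) + 2 * K ^ 2 := by
        rw [(isMean_binE n).add_const, (isMean_binE n).const_mul, (isMean_binE n).const_mul]
    _ ≤ _ := by gcongr

theorem exists_incrementVar_sq_le (hp : IsCountLaw p) :
    ∃ C : ℝ, ∀ n : ℕ, 2 ≤ n → incrementVar p n ^ 2 ≤ C := by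
  obtain ⟨τ, L, hτ, h⟩ := hp.exists_abs_incrementVar_sub_le
  refine ⟨(incrementVar p 2) ^ 2 + (τ + |L|) ^ 2, fun n hn ↦ ?_⟩
  rcases hn.eq_or_lt with rfl | hn
  · nlinarith [sq_nonneg (τ + |L|)]
  · have h1 := abs_le.1 (h n hn)
    have h2 : L / √((n : ℝ) + 1) ≤ |L| := by
      refine (div_le_div_of_nonneg_right (le_abs_self L) (Real.sqrt_nonneg _)).trans
        (div_le_self (abs_nonneg L) ?_)
      rw [Real.one_le_sqrt]; linarith [(Nat.cast_nonneg n : (0 : ℝ) ≤ n)]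
    have h3 : 0 ≤ incrementVar p n := (hp.isMean_stepE n).nonneg fun _ ↦ sq_nonneg _
    have h4 : incrementVar p n ≤ τ + |L| := by linarith
    nlinarith [sq_nonneg (incrementVar p 2)]

end IsCountLaw

/-! ### Test functions -/

/-- `f` is twice differentiable with derivatives `f'` and `f''`, and `f''` is Lipschitz continuous
with constant `1`. -/
structure IsTestFunction (f f' f'' : ℝ → ℝ) : Prop where
  hasDerivAt : ∀ x, HasDerivAt f (f' x) x
  hasDerivAt' : ∀ x, HasDerivAt f' (f'' x) x
  lipschitz : ∀ x y, |f'' x - f'' y| ≤ |x - y|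

theorem continuous_of_abs_sub_le {g : ℝ → ℝ} (h : ∀ x y, |g x - g y| ≤ |x - y|) : Continuous g :=
  (LipschitzWith.of_dist_le_mul (K := 1) fun x y ↦ by simpa [Real.dist_eq] using h x y).continuous

theorem mem_zolotarevClass_iff {f : ℝ → ℝ} :
    f ∈ zolotarevClass ↔ ∃ f' f'' : ℝ → ℝ, IsTestFunction f f' f'' := by
  constructor
  · rintro ⟨hf, hl⟩
    refine ⟨deriv f, iteratedDeriv 2 f, fun x ↦ ?_, fun x ↦ ?_, hl⟩
    · exact (hf.differentiable (by norm_num) x).hasDerivAt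
    · have h1 : Differentiable ℝ (deriv f) := by
        simpa [iteratedDeriv_one] using hf.differentiable_iteratedDeriv 1 (by norm_num)
      rw [iteratedDeriv_succ, iteratedDeriv_one]
      exact (h1 x).hasDerivAt
  · rintro ⟨f', f'', h⟩
    have h1 : deriv f = f' := funext fun x ↦ (h.hasDerivAt x).deriv
    have h2 : deriv f' = f'' := funext fun x ↦ (h.hasDerivAt' x).deriv
    refine ⟨?_, fun x y ↦ ?_⟩
    · rw [show (2 : WithTop ℕ∞) = 1 + 1 by norm_num, contDiff_succ_iff_deriv]
      refine ⟨fun x ↦ (h.hasDerivAt x).differentiableAt, by simp, ?_⟩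
      rw [h1, contDiff_one_iff_deriv, h2]
      exact ⟨fun x ↦ (h.hasDerivAt' x).differentiableAt, continuous_of_abs_sub_le h.lipschitz⟩
    · rw [iteratedDeriv_succ, iteratedDeriv_one, h1, h2]
      exact h.lipschitz x y

theorem abs_le_pow_succ_of_hasDerivAt {R R' : ℝ → ℝ} {k : ℕ} (h0 : R 0 = 0)
    (hR : ∀ t, HasDerivAt R (R' t) t) (hb : ∀ t, |R' t| ≤ |t| ^ k) (h : ℝ) :
    |R h| ≤ |h| ^ (k + 1) := by
  have := (convex_closedBall (0 : ℝ) |h|).norm_image_sub_le_of_norm_hasDerivWithin_le (f := R)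
    (f' := R') (C := |h| ^ k) (x := 0) (y := h) (fun t _ ↦ (hR t).hasDerivWithinAt)
    (fun t ht ↦ by
      have ht' : |t| ≤ |h| := by simpa using ht
      exact (hb t).trans (pow_le_pow_left₀ (abs_nonneg t) ht' k))
    (by simp) (by simp)
  simpa [h0, pow_succ] using this

/-- The functions to which integration against the normal law is applied below: continuous with
at most cubic growth. -/
def HasCubicGrowth (g : ℝ → ℝ) : Prop :=
  Continuous g ∧ ∃ A, 0 ≤ A ∧ ∀ x, |g x| ≤ A * (1 + |x| ^ 3)

namespace IsTestFunction

variable {f f' f'' : ℝ → ℝ}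

theorem taylor (h : IsTestFunction f f' f'') (a t : ℝ) :
    |f (a + t) - f a - f' a * t - f'' a / 2 * t ^ 2| ≤ |t| ^ 3 := by
  refine abs_le_pow_succ_of_hasDerivAt (k := 2)
    (R := fun t ↦ f (a + t) - f a - f' a * t - f'' a / 2 * t ^ 2)
    (R' := fun t ↦ f' (a + t) - f' a - f'' a * t) (by simp) (fun t ↦ ?_) (fun t ↦ ?_) t
  · have h1 := (h.hasDerivAt (a + t)).comp_const_add a t
    have h2 := ((h1.sub_const (f a)).sub ((hasDerivAt_id t).const_mul (f' a))).sub
      ((hasDerivAt_pow 2 t).const_mul (f'' a / 2))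
    exact h2.congr_deriv (by simp; ring)
  · refine abs_le_pow_succ_of_hasDerivAt (k := 1) (R := fun t ↦ f' (a + t) - f' a - f'' a * t)
      (R' := fun t ↦ f'' (a + t) - f'' a) (by simp) (fun t ↦ ?_) (fun t ↦ ?_) t
    · have h1 := (h.hasDerivAt' (a + t)).comp_const_add a t
      have h2 := (h1.sub_const (f' a)).sub ((hasDerivAt_id t).const_mul (f'' a))
      exact h2.congr_deriv (by simp)
    · simpa using h.lipschitz (a + t) a

theorem continuous (h : IsTestFunction f f' f'') : Continuous f :=
  continuous_iff_continuousAt.2 fun x ↦ (h.hasDerivAt x).continuousAt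

theorem hasCubicGrowth_snd (h : IsTestFunction f f' f'') : HasCubicGrowth f'' := by
  refine ⟨continuous_of_abs_sub_le h.lipschitz, |f'' 0| + 1, by positivity, fun x ↦ ?_⟩
  have h1 := h.lipschitz x 0
  have h2 := abs_add_le (f'' x - f'' 0) (f'' 0)
  rw [sub_add_cancel] at h2
  rw [sub_zero] at h1
  have hx : 0 ≤ |x| := abs_nonneg x
  have hc : 0 ≤ |f'' 0| := abs_nonneg _
  have h3 : |x| ≤ 1 + |x| ^ 3 := by
    nlinarith [sq_nonneg (|x| - 1), mul_nonneg hx (sq_nonneg (|x| - 1))]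
  have h4 : 0 ≤ |f'' 0| * |x| ^ 3 := by positivity
  nlinarith

theorem hasCubicGrowth (h : IsTestFunction f f' f'') : HasCubicGrowth f := by
  refine ⟨h.continuous, |f 0| + |f' 0| + |f'' 0| + 1, by positivity, fun x ↦ ?_⟩
  have h1 := h.taylor 0 x
  rw [zero_add] at h1
  have hx : 0 ≤ |x| := abs_nonneg x
  have h2 : |f x| ≤ |x| ^ 3 + (|f 0| + |f' 0| * |x| + |f'' 0| / 2 * |x| ^ 2) := by
    have e : f x = (f x - f 0 - f' 0 * x - f'' 0 / 2 * x ^ 2)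
      + (f 0 + f' 0 * x + f'' 0 / 2 * x ^ 2) := by ring
    rw [e]
    refine (abs_add_le _ _).trans (add_le_add h1 ((abs_add_three _ _ _).trans (le_of_eq ?_)))
    rw [abs_mul, abs_mul, abs_div, abs_pow, abs_two]
  have h3 : |x| ≤ 1 + |x| ^ 3 := by
    nlinarith [sq_nonneg (|x| - 1), mul_nonneg hx (sq_nonneg (|x| - 1))]
  have h4 : |x| ^ 2 ≤ 1 + |x| ^ 3 := by
    nlinarith [sq_nonneg (|x| - 1), mul_nonneg hx (sq_nonneg (|x| - 1))]
  have h5 := mul_le_mul_of_nonneg_left h3 (abs_nonneg (f' 0))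
  have h6 := mul_le_mul_of_nonneg_left h4 (abs_nonneg (f'' 0))
  have h7 : 0 ≤ |f'' 0| * |x| ^ 2 := by positivity
  have h8 : 0 ≤ |f 0| * |x| ^ 3 := by positivity
  nlinarith

theorem hasCubicGrowth_fst (h : IsTestFunction f f' f'') : HasCubicGrowth f' := by
  have hc : Continuous f' := continuous_iff_continuousAt.2 fun x ↦ (h.hasDerivAt' x).continuousAt
  obtain ⟨-, A, hA, hfA⟩ := h.hasCubicGrowth
  obtain ⟨-, B, hB, hfB⟩ := h.hasCubicGrowth_snd
  refine ⟨hc, 10 * A + B + 1, by positivity, fun x ↦ ?_⟩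
  have h1 := h.taylor x 1
  have h2 : |f' x| ≤ |f (x + 1)| + |f x| + |f'' x| + 1 := by
    have := abs_le.1 h1
    simp only [abs_one, one_pow, mul_one] at this
    have a1 := abs_le.1 (le_refl |f (x + 1)|)
    have a2 := abs_le.1 (le_refl |f x|)
    have a3 := abs_le.1 (le_refl |f'' x|)
    have a4 := abs_nonneg (f'' x)
    rw [abs_le]
    constructor <;> linarith
  have h3 : |x + 1| ^ 3 ≤ 4 * (1 + |x| ^ 3) := by
    have hx : 0 ≤ |x| := abs_nonneg x
    calc |x + 1| ^ 3 ≤ (|x| + 1) ^ 3 := by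
          gcongr
          exact (abs_add_le x 1).trans (by simp)
      _ ≤ _ := by nlinarith [mul_nonneg (add_nonneg hx zero_le_one) (sq_nonneg (|x| - 1))]
  have h4 := hfA (x + 1)
  have h5 := hfA x
  have h6 := hfB x
  have h7 : 0 ≤ |x| ^ 3 := by positivity
  nlinarith

/-- Test functions are stable under translation. -/
theorem comp_add_const (h : IsTestFunction f f' f'') (c : ℝ) :
    IsTestFunction (fun x ↦ f (x + c)) (fun x ↦ f' (x + c)) (fun x ↦ f'' (x + c)) where
  hasDerivAt x := (h.hasDerivAt (x + c)).comp_add_const x c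
  hasDerivAt' x := (h.hasDerivAt' (x + c)).comp_add_const x c
  lipschitz x y := by simpa using h.lipschitz (x + c) (y + c)

/-- The scaling behind the homogeneity of order three of the Zolotarev distance. -/
theorem comp_div (h : IsTestFunction f f' f'') {s : ℝ} (hs : 0 < s) :
    IsTestFunction (fun x ↦ s ^ 3 * f (x / s)) (fun x ↦ s ^ 2 * f' (x / s))
      (fun x ↦ s * f'' (x / s)) where
  hasDerivAt x := by
    have h1 := ((h.hasDerivAt (x / s)).comp x ((hasDerivAt_id x).div_const s)).const_mul (s ^ 3)
    exact h1.congr_deriv (by field_simp)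
  hasDerivAt' x := by
    have h1 := ((h.hasDerivAt' (x / s)).comp x ((hasDerivAt_id x).div_const s)).const_mul (s ^ 2)
    exact h1.congr_deriv (by field_simp)
  lipschitz x y := by
    have := h.lipschitz (x / s) (y / s)
    rw [← mul_sub, abs_mul, abs_of_pos hs]
    calc s * |f'' (x / s) - f'' (y / s)| ≤ s * |x / s - y / s| := by gcongr
      _ = |x - y| := by
        rw [← sub_div, abs_div, abs_of_pos hs]
        field_simp

end IsTestFunction

/-! ### Gaussian averages of test functions -/

/-- The standard normal law. -/
noncomputable abbrev stdNormal : Measure ℝ := gaussianReal 0 1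

theorem integrable_abs_pow_stdNormal (k : ℕ) : Integrable (fun z : ℝ ↦ |z| ^ k) stdNormal := by
  rcases Nat.eq_zero_or_pos k with rfl | hk
  · simp
  have h := (memLp_id_gaussianReal' (μ := 0) (v := 1) (k : ℝ≥0∞) (by simp)).integrable_norm_pow
    hk.ne'
  simpa using h

theorem integrable_id_stdNormal : Integrable (fun z : ℝ ↦ z) stdNormal := by
  have h := integrable_abs_pow_stdNormal 1
  simp only [pow_one] at h
  exact (integrable_norm_iff (by fun_prop)).1 (by simpa using h)

theorem integral_sq_stdNormal : ∫ z, z ^ 2 ∂stdNormal = 1 := by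
  have h := variance_fun_id_gaussianReal (μ := 0) (v := 1)
  rw [variance_eq_integral (by fun_prop)] at h
  simpa using h

theorem HasCubicGrowth.integrable {g : ℝ → ℝ} (hg : HasCubicGrowth g) (x c : ℝ) :
    Integrable (fun z ↦ g (x + c * z)) stdNormal := by
  obtain ⟨hc, A, hA, hb⟩ := hg
  have h1 : Integrable (fun z : ℝ ↦ A * (1 + 4 * (|x| ^ 3 + |c| ^ 3 * |z| ^ 3))) stdNormal :=
    ((integrable_const _).add (((integrable_const _).add
      ((integrable_abs_pow_stdNormal 3).const_mul _)).const_mul 4)).const_mul A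
  refine h1.mono' (by fun_prop) (Eventually.of_forall fun z ↦ ?_)
  refine (hb _).trans ?_
  gcongr
  rw [← mul_pow, ← abs_mul]
  calc |x + c * z| ^ 3 ≤ (|x| + |c * z|) ^ 3 := by gcongr; exact abs_add_le _ _
    _ ≤ _ := by
      have h2 := abs_nonneg x
      have h3 := abs_nonneg (c * z)
      nlinarith [mul_nonneg (add_nonneg h2 h3) (sq_nonneg (|x| - |c * z|))]

/-- The expectation of `g (x + √s N)` for a standard normal variable `N`. -/
noncomputable def gaussE (g : ℝ → ℝ) (s x : ℝ) : ℝ := ∫ z, g (x + √s * z) ∂stdNormal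

theorem gaussE_zero (g : ℝ → ℝ) (x : ℝ) : gaussE g 0 x = g x := by simp [gaussE]

/-- A sum of independent normal variables is normal. -/
theorem gaussE_add {g : ℝ → ℝ} (hg : HasCubicGrowth g) {w u : ℝ} (hw : 0 ≤ w) (hu : 0 ≤ u)
    (x : ℝ) :
    Integrable (fun z ↦ gaussE g u (x + √w * z)) stdNormal ∧
      gaussE g (w + u) x = ∫ z, gaussE g u (x + √w * z) ∂stdNormal := by
  have hmap : ∀ s : ℝ, 0 ≤ s → stdNormal.map (fun z ↦ √s * z) = gaussianReal 0 s.toNNReal := by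
    intro s hs
    rw [gaussianReal_map_const_mul]
    congr 1
    · simp
    · ext
      simp [Real.sq_sqrt hs, hs]
  have hlaw : (stdNormal.prod stdNormal).map (fun q : ℝ × ℝ ↦ √w * q.1 + √u * q.2)
      = stdNormal.map (fun z ↦ √(w + u) * z) := by
    have h1 := gaussianReal_conv_gaussianReal (m₁ := 0) (m₂ := 0) (v₁ := w.toNNReal)
      (v₂ := u.toNNReal)
    rw [add_zero, ← Real.toNNReal_add hw hu, ← hmap w hw, ← hmap u hu,
      ← hmap (w + u) (add_nonneg hw hu), Measure.conv,
      Measure.map_prod_map _ _ (by fun_prop) (by fun_prop),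
      Measure.map_map (by fun_prop) (by fun_prop)] at h1
    exact h1
  have hc := hg.1
  have hint : Integrable (fun q : ℝ × ℝ ↦ g (x + (√w * q.1 + √u * q.2)))
      (stdNormal.prod stdNormal) := by
    have h2 : Integrable (fun y ↦ g (x + y))
        ((stdNormal.prod stdNormal).map (fun q : ℝ × ℝ ↦ √w * q.1 + √u * q.2)) := by
      rw [hlaw, integrable_map_measure (by fun_prop) (by fun_prop)]
      exact hg.integrable x _
    exact h2.comp_measurable (by fun_prop)
  have h3 := hint.integral_prod_left
  have h4 := integral_prod _ hint
  simp only [← add_assoc] at h3 h4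
  refine ⟨h3, ?_⟩
  change _ = ∫ z, ∫ y, g (x + √w * z + √u * y) ∂stdNormal ∂stdNormal
  rw [← h4]
  have h5 : ∫ y, g (x + y) ∂(stdNormal.map (fun z ↦ √(w + u) * z)) = gaussE g (w + u) x := by
    rw [integral_map (by fun_prop) (by fun_prop)]; rfl
  rw [← h5, ← hlaw, integral_map (by fun_prop) (by fun_prop)]
  simp only [← add_assoc]

theorem abs_integral_le {g b : ℝ → ℝ} (hb : Integrable b stdNormal)
    (h : ∀ z, |g z| ≤ b z) : |∫ z, g z ∂stdNormal| ≤ ∫ z, b z ∂stdNormal :=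
  norm_integral_le_of_norm_le (f := g) hb (Eventually.of_forall h)

namespace IsTestFunction

variable {f f' f'' : ℝ → ℝ}

/-- Expansion of the Gaussian average in the space variable. -/
theorem abs_gaussE_sub_le (h : IsTestFunction f f' f'') (w x : ℝ) :
    |gaussE f w x - gaussE f w 0 - x * gaussE f' w 0 - x ^ 2 / 2 * gaussE f'' w 0| ≤ |x| ^ 3 := by
  unfold gaussE
  have i0 := h.hasCubicGrowth.integrable x √w
  have i1 := h.hasCubicGrowth.integrable 0 √w
  have i2 := (h.hasCubicGrowth_fst.integrable 0 √w).const_mul x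
  have i3 := (h.hasCubicGrowth_snd.integrable 0 √w).const_mul (x ^ 2 / 2)
  have i01 : Integrable (fun z ↦ f (x + √w * z) - f (0 + √w * z)) stdNormal := i0.sub i1
  have i012 : Integrable (fun z ↦ f (x + √w * z) - f (0 + √w * z) - x * f' (0 + √w * z))
    stdNormal := i01.sub i2
  rw [← integral_sub i0 i1, ← integral_const_mul, ← integral_const_mul, ← integral_sub i01 i2,
    ← integral_sub i012 i3]
  refine (abs_integral_le (b := fun _ ↦ |x| ^ 3) (integrable_const _) fun z ↦ ?_).trans (by simp)
  have := h.taylor (0 + √w * z) x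
  rw [show x + √w * z = 0 + √w * z + x by ring]
  convert this using 2
  ring

theorem abs_gaussE_snd_sub_le (h : IsTestFunction f f' f'') (w x : ℝ) :
    |gaussE f'' w x - gaussE f'' w 0| ≤ |x| := by
  unfold gaussE
  rw [← integral_sub (h.hasCubicGrowth_snd.integrable x √w)
    (h.hasCubicGrowth_snd.integrable 0 √w)]
  refine (abs_integral_le (b := fun _ ↦ |x|) (integrable_const _) fun z ↦ ?_).trans (by simp)
  refine (h.lipschitz _ _).trans (le_of_eq ?_)
  congr 1
  ring

theorem abs_gaussE_snd_add_sub_le (h : IsTestFunction f f' f'') {w u : ℝ} (hw : 0 ≤ w)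
    (hu : 0 ≤ u) (x : ℝ) :
    |gaussE f'' (w + u) x - gaussE f'' w x| ≤ √u * ∫ z, |z| ∂stdNormal := by
  unfold gaussE
  rw [← integral_sub (h.hasCubicGrowth_snd.integrable x _)
    (h.hasCubicGrowth_snd.integrable x _), ← integral_const_mul]
  refine abs_integral_le ?_ fun z ↦ ?_
  · simpa using (integrable_abs_pow_stdNormal 1).const_mul √u
  refine (h.lipschitz _ _).trans ?_
  rw [show x + √(w + u) * z - (x + √w * z) = (√(w + u) - √w) * z by ring, abs_mul]
  gcongr
  rw [abs_of_nonneg (sub_nonneg.2 (Real.sqrt_le_sqrt (by linarith)))]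
  have : √(w + u) ≤ √w + √u := by
    rw [Real.sqrt_le_left (by positivity)]
    nlinarith [Real.sq_sqrt hw, Real.sq_sqrt hu,
      mul_nonneg (Real.sqrt_nonneg w) (Real.sqrt_nonneg u)]
  linarith

/-- Expansion of the Gaussian average in the variance. -/
theorem abs_gaussE_add_sub_le (h : IsTestFunction f f' f'') {w u : ℝ} (hw : 0 ≤ w) (hu : 0 ≤ u)
    (x : ℝ) :
    |gaussE f (w + u) x - gaussE f w x - u / 2 * gaussE f'' w x|
      ≤ u * √u * ∫ z, |z| ^ 3 ∂stdNormal := by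
  have hsmall : ∀ b, |gaussE f u b - f b - u / 2 * f'' b| ≤ u * √u * ∫ z, |z| ^ 3 ∂stdNormal := by
    intro b
    have i0 := h.hasCubicGrowth.integrable b √u
    have i1 : Integrable (fun z ↦ f' b * √u * z) stdNormal := integrable_id_stdNormal.const_mul _
    have i2 : Integrable (fun z ↦ f'' b / 2 * u * z ^ 2) stdNormal := by
      simpa using (integrable_abs_pow_stdNormal 2).const_mul (f'' b / 2 * u)
    have e : gaussE f u b - f b - u / 2 * f'' b
        = ∫ z, f (b + √u * z) - f b - f' b * √u * z - f'' b / 2 * u * z ^ 2 ∂stdNormal := by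
      have i01 : Integrable (fun z ↦ f (b + √u * z) - f b) stdNormal := i0.sub (integrable_const _)
      have i012 : Integrable (fun z ↦ f (b + √u * z) - f b - f' b * √u * z) stdNormal := i01.sub i1
      rw [integral_sub i012 i2, integral_sub i01 i1, integral_sub i0 (integrable_const _),
        integral_const_mul, integral_const_mul, integral_id_gaussianReal, integral_sq_stdNormal]
      simp [gaussE]
      ring
    rw [e, ← integral_const_mul]
    refine abs_integral_le ((integrable_abs_pow_stdNormal 3).const_mul _) fun z ↦ ?_
    have h1 := h.taylor b (√u * z)
    have hs : √u ^ 2 = u := Real.sq_sqrt hu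
    rw [mul_pow, hs] at h1
    rw [show f (b + √u * z) - f b - f' b * √u * z - f'' b / 2 * u * z ^ 2
      = f (b + √u * z) - f b - f' b * (√u * z) - f'' b / 2 * (u * z ^ 2) by ring]
    refine h1.trans (le_of_eq ?_)
    rw [abs_mul, mul_pow, abs_of_nonneg (Real.sqrt_nonneg u), pow_succ √u 2, hs]
  obtain ⟨hi, he⟩ := gaussE_add h.hasCubicGrowth hw hu x
  have i1 := h.hasCubicGrowth.integrable x √w
  have i2 := (h.hasCubicGrowth_snd.integrable x √w).const_mul (u / 2)
  rw [he]
  conv_lhs => rw [gaussE, gaussE]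
  have i12 : Integrable (fun z ↦ gaussE f u (x + √w * z) - f (x + √w * z)) stdNormal := hi.sub i1
  rw [← integral_const_mul, ← integral_sub hi i1, ← integral_sub i12 i2]
  refine (abs_integral_le (b := fun _ ↦ u * √u * ∫ z, |z| ^ 3 ∂stdNormal) (integrable_const _)
    fun z ↦ ?_).trans (by simp)
  exact hsmall _

end IsTestFunction

/-- The joint expansion of the Gaussian average of a test function around mean `0` and variance
`w`, with a constant that depends neither on the test function nor on `w`. -/
theorem exists_abs_gaussE_sub_le : ∃ C : ℝ, 0 ≤ C ∧
    ∀ {f f' f'' : ℝ → ℝ}, IsTestFunction f f' f'' → ∀ w s x : ℝ, 0 ≤ w → 0 ≤ s →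
      |gaussE f s x - gaussE f w 0 - x * gaussE f' w 0 - (x ^ 2 + (s - w)) / 2 * gaussE f'' w 0|
        ≤ C * (1 + |x| ^ 3 + (s - w) ^ 2) := by
  set c₁ := ∫ z, |z| ∂stdNormal with hc₁
  set c₃ := ∫ z, |z| ^ 3 ∂stdNormal with hc₃
  have h1 : 0 ≤ c₁ := integral_nonneg fun z ↦ abs_nonneg z
  have h3 : 0 ≤ c₃ := integral_nonneg fun z ↦ by positivity
  refine ⟨c₁ + c₃ + 2, by positivity, fun {f f' f''} h w s x hw hs ↦ ?_⟩
  have hT := h.abs_gaussE_sub_le w x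
  have hx := h.abs_gaussE_snd_sub_le w x
  have hx0 := abs_nonneg x
  -- the expansion in the variance at `x`; for `s < w` it is centered at `s` and then moved to `w`
  have hV : ∃ u, 0 ≤ u ∧ u ^ 2 = (s - w) ^ 2 ∧ |s - w| = u ∧
      |gaussE f s x - gaussE f w x - (s - w) / 2 * gaussE f'' w x| ≤ (c₁ + c₃) * (u * √u) := by
    rcases le_total w s with hws | hws
    · refine ⟨s - w, by linarith, rfl, abs_of_nonneg (by linarith), ?_⟩
      have := h.abs_gaussE_add_sub_le hw (sub_nonneg.2 hws) x
      rw [add_sub_cancel] at this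
      refine this.trans ?_
      have : 0 ≤ c₁ * ((s - w) * √(s - w)) :=
        mul_nonneg h1 (mul_nonneg (by linarith) (Real.sqrt_nonneg _))
      linarith
    · refine ⟨w - s, by linarith, by ring, by rw [abs_sub_comm, abs_of_nonneg (by linarith)], ?_⟩
      have ha := h.abs_gaussE_add_sub_le hs (sub_nonneg.2 hws) x
      have hb := h.abs_gaussE_snd_add_sub_le hs (sub_nonneg.2 hws) x
      rw [add_sub_cancel, ← hc₃] at ha
      rw [add_sub_cancel, ← hc₁] at hb
      have e : gaussE f s x - gaussE f w x - (s - w) / 2 * gaussE f'' w x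
          = -(gaussE f w x - gaussE f s x - (w - s) / 2 * gaussE f'' s x)
            + (w - s) / 2 * (gaussE f'' w x - gaussE f'' s x) := by ring
      rw [e]
      refine (abs_add_le _ _).trans ?_
      rw [abs_neg, abs_mul, abs_of_nonneg (by linarith : 0 ≤ (w - s) / 2)]
      have hc : (w - s) / 2 * |gaussE f'' w x - gaussE f'' s x| ≤ (w - s) / 2 * (√(w - s) * c₁) :=
        mul_le_mul_of_nonneg_left hb (by linarith)
      have : 0 ≤ (w - s) * (√(w - s) * c₁) :=
        mul_nonneg (by linarith) (mul_nonneg (Real.sqrt_nonneg _) h1)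
      nlinarith
  obtain ⟨u, hu, hu2, hua, hV⟩ := hV
  have hus : u * √u ≤ 1 + u ^ 2 := by
    have : √u ≤ (1 + u) / 2 := by
      rw [Real.sqrt_le_left (by linarith)]; nlinarith [sq_nonneg (u - 1)]
    nlinarith [sq_nonneg (u - 1)]
  have hux : u * |x| ≤ 1 + |x| ^ 3 + u ^ 2 := by
    nlinarith [sq_nonneg (u - |x|), sq_nonneg (|x| - 1), mul_nonneg hx0 (sq_nonneg (|x| - 1))]
  have e : gaussE f s x - gaussE f w 0 - x * gaussE f' w 0 - (x ^ 2 + (s - w)) / 2 * gaussE f'' w 0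
      = (gaussE f s x - gaussE f w x - (s - w) / 2 * gaussE f'' w x)
        + (gaussE f w x - gaussE f w 0 - x * gaussE f' w 0 - x ^ 2 / 2 * gaussE f'' w 0)
        + (s - w) / 2 * (gaussE f'' w x - gaussE f'' w 0) := by ring
  rw [e]
  refine (abs_add_three _ _ _).trans ?_
  rw [abs_mul, abs_div, abs_two, hua, ← hu2]
  have h4 : u / 2 * |gaussE f'' w x - gaussE f'' w 0| ≤ u / 2 * |x| :=
    mul_le_mul_of_nonneg_left hx (by linarith)
  have h5 : (c₁ + c₃) * (u * √u) ≤ (c₁ + c₃) * (1 + u ^ 2) := by gcongr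
  have h6 : 0 ≤ (c₁ + c₃) * |x| ^ 3 := by positivity
  have h7 : 0 ≤ |x| ^ 3 := by positivity
  nlinarith

/-! ### Normal approximation of the finitely supported laws -/

theorem gaussE_eq_comp_add_const (f : ℝ → ℝ) (s x : ℝ) :
    gaussE f s x = gaussE (fun y ↦ f (y + x)) s 0 := by
  unfold gaussE
  congr 1
  funext z
  congr 1
  ring

namespace IsCountLaw

variable {p : ℕ → ℕ → ℝ}

/-- The event `I₁ = n` has probability `2⁻ⁿ`, and it forces the second group to be empty. -/
theorem stepE_le (hp : IsCountLaw p) {n : ℕ} (hn : 1 ≤ n) {F : ℕ × ℕ × ℕ → ℝ} {h : ℕ → ℝ}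
    (hF : ∀ i : ℕ × ℕ × ℕ, i.1 < n → F i ≤ h i.1) :
    stepE p n F ≤ ∑ j ∈ Finset.range n, (n.choose j / 2 ^ n : ℝ) * h j + F (n, 0, 0) / 2 ^ n := by
  unfold stepE
  rw [Finset.sum_range_succ _ n]
  refine add_le_add (Finset.sum_le_sum fun j hj ↦ ?_) (le_of_eq ?_)
  · rw [← sum_stepWeight_right, Finset.sum_mul]
    refine Finset.sum_le_sum fun k _ ↦ mul_le_mul_of_nonneg_left ?_ (stepWeight_nonneg _ _ _)
    rw [← (hp.isMean_countE k).const (h j)]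
    exact (hp.isMean_countE k).mono _ _ fun b ↦ hF (j, k, b) (Finset.mem_range.1 hj)
  · obtain ⟨m, rfl⟩ : ∃ m, n = m + 1 := ⟨n - 1, by omega⟩
    rw [Finset.sum_eq_single 0]
    · rw [hp.countE_zero, stepWeight_succ, if_pos (by omega)]
      simp
      ring
    · intro k _ hk
      rw [stepWeight_succ, if_neg (by omega), zero_mul]
    · simp

/-- Replacing the centered first group by a normal variable with the same variance changes the
expectation of a test function by a bounded amount: the increment has mean zero, so that the first
two orders of the expansion of the Gaussian average cancel. -/
theorem exists_abs_stepE_gaussE_sub_le (hp : IsCountLaw p) : ∃ R : ℝ, 0 ≤ R ∧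
    ∀ {f f' f'' : ℝ → ℝ}, IsTestFunction f f' f'' → ∀ n : ℕ, 2 ≤ n →
      |stepE p n (fun i ↦ gaussE f (countVar p i.1) (increment p n i))
        - gaussE f (countVar p n) 0| ≤ R := by
  obtain ⟨C, hC0, hC⟩ := exists_abs_gaussE_sub_le
  obtain ⟨C₁, hC₁⟩ := hp.exists_stepE_abs_increment_pow_three_le
  obtain ⟨C₂, hC₂⟩ := hp.exists_binE_countVar_sq_sub_le
  obtain ⟨C₃, hC₃⟩ := hp.exists_incrementVar_sq_le
  have key : ∀ {f f' f'' : ℝ → ℝ}, IsTestFunction f f' f'' → ∀ n : ℕ, 2 ≤ n →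
      |stepE p n (fun i ↦ gaussE f (countVar p i.1) (increment p n i))
        - gaussE f (countVar p n) 0| ≤ C * (1 + C₁ + C₂) + C * (1 + C₃) := by
    intro f f' f'' hf n hn
    set w := binE n (countVar p) with hw
    have hw0 : 0 ≤ w := (isMean_binE n).nonneg hp.countVar_nonneg
    set g₀ := gaussE f w 0
    set g₁ := gaussE f' w 0
    set g₂ := gaussE f'' w 0
    have hE := hp.isMean_stepE n
    have h1 : stepE p n (fun i ↦ g₀ + increment p n i * g₁
        + (increment p n i ^ 2 + (countVar p i.1 - w)) / 2 * g₂)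
        = g₀ + incrementVar p n / 2 * g₂ := by
      have e : (fun i : ℕ × ℕ × ℕ ↦ g₀ + increment p n i * g₁
          + (increment p n i ^ 2 + (countVar p i.1 - w)) / 2 * g₂)
          = fun i ↦ g₁ * increment p n i
            + g₂ / 2 * (increment p n i ^ 2 + (countVar p i.1 - w)) + g₀ := by
        funext i; ring
      rw [e, hE.add_const, hE.add, hE.const_mul, hE.const_mul, hE.add, hE.sub_const,
        hp.stepE_fst, hp.stepE_increment hn, sub_self, incrementVar]
      ring
    have h2 : |stepE p n (fun i ↦ gaussE f (countVar p i.1) (increment p n i))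
        - (g₀ + incrementVar p n / 2 * g₂)| ≤ C * (1 + C₁ + C₂) := by
      rw [← h1, ← hE.sub]
      refine (hE.abs_le _).trans ?_
      have h3 : stepE p n (fun i ↦ |gaussE f (countVar p i.1) (increment p n i)
          - (g₀ + increment p n i * g₁
            + (increment p n i ^ 2 + (countVar p i.1 - w)) / 2 * g₂)|)
          ≤ stepE p n (fun i ↦ C * (|increment p n i| ^ 3 + (countVar p i.1 - w) ^ 2 + 1)) := by
        refine hE.mono _ _ fun i ↦ ?_
        have := hC hf w (countVar p i.1) (increment p n i) hw0 (hp.countVar_nonneg _)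
        convert this using 2 <;> ring
      refine h3.trans ?_
      rw [hE.const_mul, hE.add_const, hE.add, hp.stepE_fst n fun j ↦ (countVar p j - w) ^ 2]
      have := hC₁ n (by omega)
      have := hC₂ n (by omega)
      rw [show 1 + C₁ + C₂ = C₁ + C₂ + 1 by ring]
      gcongr
    have h4 : |gaussE f (countVar p n) 0 - (g₀ + incrementVar p n / 2 * g₂)| ≤ C * (1 + C₃) := by
      have h5 := hC hf w (countVar p n) 0 hw0 (hp.countVar_nonneg _)
      have h6 : countVar p n - w = incrementVar p n := by rw [hp.countVar_eq hn]; ring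
      rw [h6] at h5
      have h7 : C * (1 + |(0 : ℝ)| ^ 3 + incrementVar p n ^ 2) ≤ C * (1 + C₃) := by
        have := hC₃ n hn
        gcongr
        simp
      refine le_trans (le_of_eq ?_) (h5.trans h7)
      congr 1
      ring
    have h8 := abs_sub_le (stepE p n (fun i ↦ gaussE f (countVar p i.1) (increment p n i)))
      (g₀ + incrementVar p n / 2 * g₂) (gaussE f (countVar p n) 0)
    rw [abs_sub_comm (g₀ + incrementVar p n / 2 * g₂)] at h8
    linarith
  exact ⟨max 0 (C * (1 + C₁ + C₂) + C * (1 + C₃)), le_max_left _ _,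
    fun hf n hn ↦ (key hf n hn).trans (le_max_right _ _)⟩

/-- The distance between the centered law and the normal law of the same variance, measured by
test functions, grows at most logarithmically. -/
theorem exists_abs_countE_sub_gaussE_le (hp : IsCountLaw p) : ∃ C : ℝ, 0 ≤ C ∧
    ∀ {f f' f'' : ℝ → ℝ}, IsTestFunction f f' f'' → ∀ n : ℕ,
      |countE p n (fun a ↦ f (a - countMean p n)) - gaussE f (countVar p n) 0|
        ≤ C * (harmonic n : ℝ) := by
  obtain ⟨R, hR0, hR⟩ := hp.exists_abs_stepE_gaussE_sub_le
  refine ⟨2 * R, by positivity, fun {f f' f''} hf n ↦ ?_⟩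
  induction n using Nat.strong_induction_on generalizing f f' f'' with
  | _ n ih =>
    rcases lt_or_ge n 2 with hn | hn
    · have h0 : countMean p 0 = 0 := by simp [countMean, hp.countE_zero]
      have h1 : countMean p 1 = 0 := by simp [countMean, hp.countE_one]
      have : 0 ≤ 2 * R * (harmonic n : ℝ) := mul_nonneg (by positivity) (harmonic_nonneg n)
      interval_cases n
      · simp [hp.countVar_zero, gaussE_zero, hp.countE_zero, h0]
      · simpa [hp.countVar_one, gaussE_zero, hp.countE_one, h1] using this
    set A := |countE p n (fun a ↦ f (a - countMean p n)) - gaussE f (countVar p n) 0| with hA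
    refine le_of_le_binE_step (n := n) (h := fun n ↦ 2 * R * (harmonic n : ℝ)) (e := R)
      (by omega) ?_ ?_
    · set G : ℕ × ℕ × ℕ → ℝ := fun i ↦
        countE p i.1 (fun a ↦ f (a - countMean p i.1 + increment p n i))
          - gaussE f (countVar p i.1) (increment p n i) with hG
      have hsplit : countE p n (fun a ↦ f (a - countMean p n)) - gaussE f (countVar p n) 0
          = stepE p n G + (stepE p n (fun i ↦ gaussE f (countVar p i.1) (increment p n i))
            - gaussE f (countVar p n) 0) := by
        rw [hG, (hp.isMean_stepE n).sub, hp.countE_centered hn]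
        ring
      have hself : |G (n, 0, 0)| = A := by
        simp [hG, hA, increment]
      have h1 : |stepE p n G| ≤ ∑ j ∈ Finset.range n,
          (n.choose j / 2 ^ n : ℝ) * (2 * R * (harmonic j : ℝ)) + A / 2 ^ n := by
        refine ((hp.isMean_stepE n).abs_le _).trans ?_
        rw [← hself]
        refine hp.stepE_le (F := fun i ↦ |G i|) (h := fun j ↦ 2 * R * (harmonic j : ℝ))
          (by omega) fun i hi ↦ ?_
        have := ih i.1 hi (hf.comp_add_const (increment p n i))
        rw [← gaussE_eq_comp_add_const] at this
        exact this
      rw [hA, hsplit]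
      refine (abs_add_le _ _).trans ?_
      rw [← hsplit, ← hA]
      exact add_le_add h1 (hR hf n hn)
    · rw [(isMean_binE n).const_mul, binE_harmonic]
      have := half_le_harmonicGap (n := n) (by omega)
      nlinarith

theorem exists_log_le_mul_countVar (hp : IsCountLaw p) :
    ∃ B : ℝ, 0 < B ∧ ∀ n : ℕ, 2 ≤ n → Real.log n ≤ B * countVar p n := by
  obtain ⟨s, K, hs, hK0, hK⟩ := hp.exists_abs_countVar_sub_le
  have hlim : Tendsto (fun n : ℕ ↦ s / 2 * Real.log n) atTop atTop :=
    (Real.tendsto_log_atTop.comp tendsto_natCast_atTop_atTop).const_mul_atTop (by positivity)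
  obtain ⟨N, hN⟩ := eventually_atTop.1 (hlim.eventually_ge_atTop K)
  obtain ⟨B, hB0, hB⟩ := exists_forall_lt_le (fun n : ℕ ↦ Real.log n / countVar p n) N
  refine ⟨B + 2 / s, by positivity, fun n hn ↦ ?_⟩
  have hv := hp.countVar_pos hn
  rcases lt_or_ge n N with h | h
  · have h1 := hB n h
    rw [div_le_iff₀ hv] at h1
    have : 0 ≤ 2 / s * countVar p n := by positivity
    linarith
  · have h1 := hN n h
    have h2 := (abs_le.1 (hK n)).1
    have h3 := log_add_one_le_harmonic n
    have h4 : Real.log n ≤ Real.log ((n + 1 : ℕ) : ℝ) := by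
      refine Real.log_le_log (by exact_mod_cast (by omega : 0 < n)) (by push_cast; linarith)
    have h5 : s * Real.log n ≤ s * (harmonic n : ℝ) := by gcongr; linarith
    have h6 : s / 2 * Real.log n ≤ countVar p n := by linarith
    have h7 : Real.log n ≤ 2 / s * countVar p n := by
      rw [div_mul_eq_mul_div, le_div_iff₀ hs]; linarith
    have : 0 ≤ B * countVar p n := by positivity
    linarith

/-- The variance is asymptotically proportional to `log n`. -/
theorem exists_tendsto_countVar_div_log (hp : IsCountLaw p) :
    ∃ s : ℝ, 0 < s ∧ Tendsto (fun n : ℕ ↦ countVar p n / (s * Real.log n)) atTop (nhds 1) := by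
  obtain ⟨s, K, hs, hK0, hK⟩ := hp.exists_abs_countVar_sub_le
  refine ⟨s, hs, ?_⟩
  have hlim : Tendsto (fun n : ℕ ↦ s * Real.log n) atTop atTop :=
    (Real.tendsto_log_atTop.comp tendsto_natCast_atTop_atTop).const_mul_atTop hs
  rw [tendsto_iff_norm_sub_tendsto_zero]
  refine squeeze_zero' (Eventually.of_forall fun _ ↦ norm_nonneg _) ?_
    ((tendsto_const_nhds (x := K + s)).div_atTop hlim)
  filter_upwards [eventually_ge_atTop 2] with n hn
  have hl : 0 < Real.log n := Real.log_pos (by exact_mod_cast (by omega : 1 < n))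
  have h2 := abs_le.1 (hK n)
  have h3 := log_add_one_le_harmonic n
  have h4 : Real.log n ≤ Real.log ((n + 1 : ℕ) : ℝ) := by
    refine Real.log_le_log (by exact_mod_cast (by omega : 0 < n)) (by push_cast; linarith)
  have h5 := harmonic_le_one_add_log n
  have h6 : s * Real.log n ≤ s * (harmonic n : ℝ) := by gcongr; linarith
  have h7 : s * (harmonic n : ℝ) ≤ s * (1 + Real.log n) := by gcongr
  have hne : s * Real.log n ≠ 0 := by positivity
  rw [div_sub_one hne, Real.norm_eq_abs, abs_div, abs_of_pos (by positivity : 0 < s * Real.log n)]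
  gcongr
  rw [abs_le]
  constructor <;> nlinarith

/-- The normal approximation after standardization, with the rate `1 / √(log n)`: the error
`O(log n)` is divided by the third power of the standard deviation. -/
theorem exists_abs_countE_standardize_sub_le (hp : IsCountLaw p) : ∃ C : ℝ, 0 ≤ C ∧
    ∀ {f f' f'' : ℝ → ℝ}, IsTestFunction f f' f'' → ∀ n : ℕ, 2 ≤ n →
      |countE p n (fun a ↦ f ((a - countMean p n) / √(countVar p n))) - ∫ z, f z ∂stdNormal|
        ≤ C / √(Real.log n) := by
  obtain ⟨C, hC0, hC⟩ := hp.exists_abs_countE_sub_gaussE_le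
  obtain ⟨B, hB0, hB⟩ := hp.exists_log_le_mul_countVar
  have hl2 : 0 < Real.log 2 := Real.log_pos (by norm_num)
  refine ⟨C * (1 / Real.log 2 + 1) * (B * √B), by positivity, fun {f f' f''} hf n hn ↦ ?_⟩
  have hv := hp.countVar_pos hn
  set s := √(countVar p n) with hs
  have hsp : 0 < s := Real.sqrt_pos.2 hv
  have hss : s ^ 2 = countVar p n := Real.sq_sqrt hv.le
  have h1 := hC (hf.comp_div hsp) n
  rw [(hp.isMean_countE n).const_mul] at h1
  have h2 : gaussE (fun x ↦ s ^ 3 * f (x / s)) (countVar p n) 0 = s ^ 3 * ∫ z, f z ∂stdNormal := by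
    unfold gaussE
    rw [← hs, integral_const_mul]
    congr 2
    funext z
    rw [zero_add, mul_div_cancel_left₀ _ hsp.ne']
  rw [h2, ← mul_sub, abs_mul, abs_of_pos (by positivity : 0 < s ^ 3)] at h1
  set E := |countE p n (fun a ↦ f ((a - countMean p n) / s)) - ∫ z, f z ∂stdNormal|
  have hl : 0 < Real.log n := Real.log_pos (by exact_mod_cast (by omega : 1 < n))
  have hH : (harmonic n : ℝ) ≤ (1 / Real.log 2 + 1) * Real.log n := by
    refine (harmonic_le_one_add_log n).trans ?_
    have h3 : Real.log 2 ≤ Real.log n :=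
      Real.log_le_log (by norm_num) (by exact_mod_cast hn)
    have h4 : 1 ≤ 1 / Real.log 2 * Real.log n := by
      rw [one_div_mul_eq_div, one_le_div hl2]; exact h3
    linarith
  have hls : Real.log n ≤ B * s ^ 2 := by rw [hss]; exact hB n hn
  set r := √(Real.log n) with hr
  have hrp : 0 < r := Real.sqrt_pos.2 hl
  have hrr : r ^ 2 = Real.log n := Real.sq_sqrt hl.le
  have hrs : r ≤ √B * s := by
    rw [hr, Real.sqrt_le_left (by positivity), mul_pow, Real.sq_sqrt hB0.le]
    exact hls
  rw [le_div_iff₀ hrp]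
  have h5 : s ^ 3 * E * r ≤ s ^ 3 * (C * (1 / Real.log 2 + 1) * (B * √B)) := by
    calc s ^ 3 * E * r ≤ (C * (harmonic n : ℝ)) * r := mul_le_mul_of_nonneg_right h1 hrp.le
      _ ≤ C * ((1 / Real.log 2 + 1) * (B * s ^ 2)) * (√B * s) := by
          have h7 : (harmonic n : ℝ) ≤ (1 / Real.log 2 + 1) * (B * s ^ 2) :=
            hH.trans (mul_le_mul_of_nonneg_left hls (by positivity))
          gcongr
      _ = _ := by ring
  have h6 : s ^ 3 * (E * r) ≤ s ^ 3 * (C * (1 / Real.log 2 + 1) * (B * √B)) := by linarith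
  exact le_of_mul_le_mul_left h6 (by positivity)

end IsCountLaw

/-! ### Reduction to finitely supported laws -/

/-- The possible values of `Yₙ`: the integers between `0` and `n²`. -/
def countValues (n : ℕ) : Set ℝ := (fun l : ℕ ↦ (l : ℝ)) '' Set.Iic (n ^ 2)

theorem measurableSet_countValues (n : ℕ) : MeasurableSet (countValues n) :=
  ((Set.finite_Iic _).image _).measurableSet

theorem zero_mem_countValues (n : ℕ) : (0 : ℝ) ∈ countValues n := ⟨0, by simp, by simp⟩

/-- The quadratic bound is reproduced by the recursion. -/
theorem add_mem_countValues {n j k : ℕ} (hj : j < n) (h : indexProb n j k ≠ 0) {x y : ℝ}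
    (hx : x ∈ countValues j) (hy : y ∈ countValues k) :
    x + y + ((n : ℝ) - j) ∈ countValues n := by
  obtain ⟨a, ha, rfl⟩ := hx
  obtain ⟨b, hb, rfl⟩ := hy
  rw [Set.mem_Iic] at ha hb
  refine ⟨a + b + (n - j), ?_, by push_cast [Nat.cast_sub hj.le]; ring⟩
  rw [Set.mem_Iic]
  obtain ⟨d, rfl⟩ : ∃ d, n = j + d := ⟨n - j, by omega⟩
  rw [Nat.add_sub_cancel_left]
  by_cases h0 : j = 0 ∧ k = 0
  · obtain ⟨rfl, rfl⟩ := h0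
    nlinarith
  · unfold indexProb at h
    rw [if_neg h0] at h
    have h1 : 1 ≤ j ∧ j + k ≤ j + d := by
      by_contra hc
      exact h (if_neg hc)
    have h2 : k ≤ d := by omega
    have h3 : k ^ 2 ≤ d ^ 2 := Nat.pow_le_pow_left h2 2
    have h4 : d ≤ j * d := Nat.le_mul_of_pos_left d h1.1
    nlinarith

theorem indexProb_ne_top (n j k : ℕ) : indexProb n j k ≠ ⊤ := by
  unfold indexProb
  split_ifs
  · simp
  · exact ENNReal.mul_ne_top (ENNReal.natCast_ne_top _) (by simp)
  · simp

theorem integral_indexLaw (n : ℕ) (φ : ℕ × ℕ → ℝ) :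
    ∫ i, φ i ∂(indexLaw n) = ∑ j ∈ Finset.range (n + 1), ∑ k ∈ Finset.range (n + 1),
      stepWeight n j k * φ (j, k) := by
  have hi : ∀ j k, Integrable φ (indexProb n j k • Measure.dirac (j, k)) := fun j k ↦
    (integrable_dirac (by simp)).smul_measure (indexProb_ne_top n j k)
  rw [indexLaw, integral_finsetSum_measure fun j _ ↦
    integrable_finsetSum_measure.2 fun k _ ↦ hi j k]
  refine Finset.sum_congr rfl fun j _ ↦ ?_
  rw [integral_finsetSum_measure fun k _ ↦ hi j k]
  refine Finset.sum_congr rfl fun k _ ↦ ?_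
  rw [integral_smul_measure, integral_dirac, smul_eq_mul, stepWeight]

/-- The probability of `Yₙ = ℓ`. -/
noncomputable def countProb {Ω : Type*} [MeasurableSpace Ω] (μ : Measure Ω) (Y : ℕ → Ω → ℝ)
    (n l : ℕ) : ℝ :=
  μ.real (Y n ⁻¹' {(l : ℝ)})

end ComparisonCount

namespace IsComparisonCount

open ComparisonCount

variable {Ω : Type*} [MeasurableSpace Ω] {μ : Measure Ω} {Y : ℕ → Ω → ℝ}

theorem measurable_standardize (hY : IsComparisonCount μ Y) (n : ℕ) :
    Measurable (standardize μ (Y n)) :=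
  ((hY.measurable n).sub_const _).div_const _

theorem measurable_step (hY : IsComparisonCount μ Y) (n : ℕ) :
    Measurable (fun q : (ℕ × ℕ) × (Ω × Ω) ↦
      Y q.1.1 q.2.1 + Y q.1.2 q.2.2 + ((n : ℝ) - (q.1.1 : ℝ))) := by
  refine measurable_from_prod_countable_right fun i ↦ ?_
  have h1 : Measurable fun q : Ω × Ω ↦ Y i.1 q.1 := (hY.measurable i.1).comp measurable_fst
  have h2 : Measurable fun q : Ω × Ω ↦ Y i.2 q.2 := (hY.measurable i.2).comp measurable_snd
  exact (h1.add h2).add_const ((n : ℝ) - (i.1 : ℝ))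

variable [IsProbabilityMeasure μ]

/-- The recursion for the law of `Yₙ`, written as a sum over the possible group sizes. -/
theorem map_apply (hY : IsComparisonCount μ Y) {n : ℕ} (hn : 2 ≤ n) {s : Set ℝ}
    (hs : MeasurableSet s) :
    μ (Y n ⁻¹' s) = ∑ j ∈ Finset.range (n + 1), ∑ k ∈ Finset.range (n + 1), indexProb n j k •
      (μ.prod μ) {q | Y j q.1 + Y k q.2 + ((n : ℝ) - (j : ℝ)) ∈ s} := by
  have hF := hY.measurable_step n
  rw [← Measure.map_apply (hY.measurable n) hs, hY.recurrence n hn, Measure.map_apply hF hs,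
    Measure.prod_apply (hF hs)]
  simp only [indexLaw, lintegral_finsetSum_measure, lintegral_smul_measure, lintegral_dirac]
  rfl

/-- Almost surely, `Yₙ` is an integer between `0` and `n²`. The term `(I₁, I₂) = (n, 0)` of the
recursion only contributes `2⁻ⁿ` times the exceptional probability itself. -/
theorem ae_mem_countValues (hY : IsComparisonCount μ Y) (n : ℕ) :
    ∀ᵐ ω ∂μ, Y n ω ∈ countValues n := by
  induction n using Nat.strong_induction_on with
  | _ n ih =>
    rcases lt_or_ge n 2 with hn | hn
    · interval_cases n
      · filter_upwards [hY.zero] with ω h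
        rw [h]
        exact zero_mem_countValues 0
      · filter_upwards [hY.one] with ω h
        rw [h]
        exact zero_mem_countValues 1
    have h1 := hY.map_apply hn (measurableSet_countValues n).compl
    rw [sum_split n hn (fun j k ↦
      (μ.prod μ) {q | Y j q.1 + Y k q.2 + ((n : ℝ) - (j : ℝ)) ∈ (countValues n)ᶜ})] at h1
    have h2 : ∑ j : Fin n, ∑ k : Fin n, indexProb n j k •
        (μ.prod μ) {q | Y j q.1 + Y k q.2 + ((n : ℝ) - ((j : ℕ) : ℝ)) ∈ (countValues n)ᶜ} = 0 := by
      refine Finset.sum_eq_zero fun j _ ↦ Finset.sum_eq_zero fun k _ ↦ ?_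
      by_cases hp : indexProb n j k = 0
      · rw [hp, zero_smul]
      have h3 : ∀ᵐ q ∂(μ.prod μ),
          Y j q.1 + Y k q.2 + ((n : ℝ) - ((j : ℕ) : ℝ)) ∈ countValues n := by
        filter_upwards [Measure.quasiMeasurePreserving_fst.ae (ih j j.2),
          Measure.quasiMeasurePreserving_snd.ae (ih k k.2)] with q hq1 hq2
        exact add_mem_countValues j.2 hp hq1 hq2
      rw [ae_iff] at h3
      simp only [Set.mem_compl_iff, h3, smul_zero]
    have h4 : (μ.prod μ) {q | Y n q.1 + Y 0 q.2 + ((n : ℝ) - (n : ℝ)) ∈ (countValues n)ᶜ}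
        = μ (Y n ⁻¹' (countValues n)ᶜ) := by
      rw [← measurePreserving_fst.measure_preimage (μa := μ.prod μ)
        (hY.measurable n (measurableSet_countValues n).compl).nullMeasurableSet]
      refine measure_congr ?_
      filter_upwards [Measure.quasiMeasurePreserving_snd.ae hY.zero] with q hq
      change (_ ∈ _) = (_ ∈ _)
      simp [hq]
    rw [h2, h4, zero_add] at h1
    change μ (Y n ⁻¹' (countValues n)ᶜ) = 0
    set x := μ (Y n ⁻¹' (countValues n)ᶜ) with hx
    have hx1 : x ≠ ⊤ := measure_ne_top _ _
    have h5 : x.toReal = (1 / 2) ^ n * x.toReal := by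
      conv_lhs => rw [h1]
      simp
    have h6 : (1 / 2 : ℝ) ^ n < 1 := pow_lt_one₀ (by norm_num) (by norm_num) (by omega)
    have h7 : x.toReal = 0 := by
      by_contra hc
      have : 0 < x.toReal := lt_of_le_of_ne ENNReal.toReal_nonneg (Ne.symm hc)
      nlinarith
    exact ((ENNReal.toReal_eq_zero_iff x).1 h7).resolve_right hx1

theorem ae_eq_sum_indicator (hY : IsComparisonCount μ Y) (n : ℕ) (g : ℝ → ℝ) :
    (fun ω ↦ g (Y n ω)) =ᵐ[μ] fun ω ↦ ∑ l ∈ Finset.range (n ^ 2 + 1),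
      (Y n ⁻¹' {(l : ℝ)}).indicator (fun _ ↦ g l) ω := by
  filter_upwards [hY.ae_mem_countValues n] with ω hω
  obtain ⟨a, ha, hω⟩ := hω
  rw [Set.mem_Iic] at ha
  rw [Finset.sum_eq_single_of_mem a (Finset.mem_range.2 (Nat.lt_succ_iff.2 ha))]
  · rw [Set.indicator_of_mem (by simpa using hω.symm), ← hω]
  · intro l _ hl
    refine Set.indicator_of_notMem (fun h ↦ hl ?_) _
    have h2 : Y n ω = l := h
    exact Nat.cast_injective (R := ℝ) (h2.symm.trans hω.symm)

theorem integrable_indicator_const (hY : IsComparisonCount μ Y) (n l : ℕ) (c : ℝ) :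
    Integrable ((Y n ⁻¹' {(l : ℝ)}).indicator (fun _ ↦ c)) μ :=
  (integrable_const c).indicator (hY.measurable n (measurableSet_singleton _))

theorem integrable_comp (hY : IsComparisonCount μ Y) (n : ℕ) (g : ℝ → ℝ) :
    Integrable (fun ω ↦ g (Y n ω)) μ :=
  (integrable_finsetSum _ fun l _ ↦ hY.integrable_indicator_const n l (g l)).congr
    (hY.ae_eq_sum_indicator n g).symm

theorem integral_comp (hY : IsComparisonCount μ Y) (n : ℕ) (g : ℝ → ℝ) :
    ∫ ω, g (Y n ω) ∂μ = countE (countProb μ Y) n (fun l ↦ g l) := by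
  rw [integral_congr_ae (hY.ae_eq_sum_indicator n g),
    integral_finsetSum _ fun l _ ↦ hY.integrable_indicator_const n l (g l)]
  refine Finset.sum_congr rfl fun l _ ↦ ?_
  rw [integral_indicator_const _ (hY.measurable n (measurableSet_singleton _))]
  rfl

theorem countE_recurrence (hY : IsComparisonCount μ Y) {n : ℕ} (hn : 2 ≤ n) (f : ℕ → ℝ) :
    countE (countProb μ Y) n f = stepE (countProb μ Y) n (fun i ↦
      countE (countProb μ Y) i.1 (fun a ↦ f (a + i.2.2 + (n - i.1)))) := by
  -- a bounded measurable function on the line that agrees with `f` at all values that occur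
  set N := 2 * n ^ 2 + n with hN
  set g : ℝ → ℝ := fun x ↦ f (min ⌊x⌋₊ N) with hg
  have hgm : Measurable g :=
    (measurable_from_nat (f := fun l ↦ f (min l N))).comp Nat.measurable_floor
  have hgf : ∀ l : ℕ, l ≤ N → g l = f l := fun l hl ↦ by simp [hg, hl]
  obtain ⟨B, hB⟩ : ∃ B, ∀ x, |g x| ≤ B := by
    refine ⟨∑ i ∈ Finset.range (N + 1), |f i|, fun x ↦ ?_⟩
    exact Finset.single_le_sum (f := fun i ↦ |f i|) (fun _ _ ↦ abs_nonneg _)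
      (Finset.mem_range.2 (Nat.lt_succ_iff.2 (min_le_right _ _)))
  have hF := hY.measurable_step n
  have hint : ∀ {α : Type _} [MeasurableSpace α] (ν : Measure α) [IsFiniteMeasure ν] (φ : α → ℝ),
      Measurable φ → Integrable (fun a ↦ g (φ a)) ν := fun ν _ φ hφ ↦
    Integrable.of_bound (hgm.comp hφ).aestronglyMeasurable B (Eventually.of_forall fun a ↦ hB _)
  have h1 : countE (countProb μ Y) n f = ∫ ω, g (Y n ω) ∂μ := by
    rw [hY.integral_comp]
    refine Finset.sum_congr rfl fun l hl ↦ ?_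
    have := Nat.lt_succ_iff.1 (Finset.mem_range.1 hl)
    simp only
    rw [hgf l (by rw [hN]; omega)]
  have h2 : ∫ ω, g (Y n ω) ∂μ = ∫ i, ∫ q : Ω × Ω, g (Y i.1 q.1 + Y i.2 q.2 + ((n : ℝ) - (i.1 : ℝ)))
      ∂(μ.prod μ) ∂(indexLaw n) := by
    rw [← integral_map (hY.measurable n).aemeasurable hgm.aestronglyMeasurable, hY.recurrence n hn,
      integral_map hF.aemeasurable hgm.aestronglyMeasurable, integral_prod _ (hint _ _ hF)]
  rw [h1, h2, integral_indexLaw, stepE]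
  refine Finset.sum_congr rfl fun j hj ↦ Finset.sum_congr rfl fun k hk ↦ ?_
  have hj' : j ≤ n := Nat.lt_succ_iff.1 (Finset.mem_range.1 hj)
  have hk' : k ≤ n := Nat.lt_succ_iff.1 (Finset.mem_range.1 hk)
  congr 1
  have hstep : Measurable fun q : Ω × Ω ↦ Y j q.1 + Y k q.2 + ((n : ℝ) - (j : ℝ)) :=
    hF.comp ((measurable_const (a := (j, k))).prodMk measurable_id)
  simp only
  rw [integral_prod_symm _ (hint _ _ hstep)]
  simp only
  have h3 : ∀ ω₂, ∫ ω₁, g (Y j ω₁ + Y k ω₂ + ((n : ℝ) - (j : ℝ))) ∂μ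
      = countE (countProb μ Y) j (fun a ↦ g (a + Y k ω₂ + ((n : ℝ) - (j : ℝ)))) := fun ω₂ ↦
    hY.integral_comp j fun x ↦ g (x + Y k ω₂ + ((n : ℝ) - (j : ℝ)))
  simp only [h3]
  rw [hY.integral_comp k fun y ↦
    countE (countProb μ Y) j (fun a ↦ g (a + y + ((n : ℝ) - (j : ℝ))))]
  refine Finset.sum_congr rfl fun b hb ↦ ?_
  congr 1
  refine Finset.sum_congr rfl fun a ha ↦ ?_
  congr 1
  have ha' := Nat.lt_succ_iff.1 (Finset.mem_range.1 ha)
  have hb' := Nat.lt_succ_iff.1 (Finset.mem_range.1 hb)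
  have hj2 := Nat.pow_le_pow_left hj' 2
  have hk2 := Nat.pow_le_pow_left hk' 2
  simp only
  rw [← hgf (a + b + (n - j)) (by rw [hN]; omega)]
  push_cast [Nat.cast_sub hj']
  rfl

/-- The laws of a sequence as in `IsComparisonCount` are finitely supported and satisfy the
recursion for such laws. -/
theorem isCountLaw (hY : IsComparisonCount μ Y) : IsCountLaw (countProb μ Y) where
  nonneg _ _ := measureReal_nonneg
  sum_eq_one n := by
    have h := hY.integral_comp n fun _ ↦ 1
    simpa [countE] using h.symm
  one := by
    have h : μ (Y 1 ⁻¹' {((1 : ℕ) : ℝ)}) = 0 := by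
      refine measure_mono_null (fun ω hω ↦ ?_) hY.one
      have h1 : Y 1 ω = ((1 : ℕ) : ℝ) := hω
      simp [h1]
    rw [countProb, measureReal_def, h, ENNReal.toReal_zero]
  recurrence n hn f := hY.countE_recurrence hn f

theorem integral_eq_countMean (hY : IsComparisonCount μ Y) (n : ℕ) :
    ∫ ω, Y n ω ∂μ = countMean (countProb μ Y) n :=
  hY.integral_comp n fun x ↦ x

theorem variance_eq_countVar (hY : IsComparisonCount μ Y) (n : ℕ) :
    variance (Y n) μ = countVar (countProb μ Y) n := by
  rw [variance_eq_integral (hY.measurable n).aemeasurable, hY.integral_eq_countMean]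
  exact hY.integral_comp n fun x ↦ (x - countMean (countProb μ Y) n) ^ 2

/-- The normal approximation of the standardized variables, for test functions. -/
theorem exists_abs_integral_standardize_sub_le (hY : IsComparisonCount μ Y) :
    ∃ C : ℝ, 0 ≤ C ∧ ∀ {f f' f'' : ℝ → ℝ}, IsTestFunction f f' f'' → ∀ n : ℕ, 2 ≤ n →
      Integrable f (μ.map (standardize μ (Y n))) ∧
      |∫ x, f x ∂(μ.map (standardize μ (Y n))) - ∫ z, f z ∂stdNormal| ≤ C / √(Real.log n) := by
  obtain ⟨C, hC0, hC⟩ := hY.isCountLaw.exists_abs_countE_standardize_sub_le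
  refine ⟨C, hC0, fun {f f' f''} hf n hn ↦ ⟨?_, ?_⟩⟩
  · rw [integrable_map_measure hf.continuous.aestronglyMeasurable
      (hY.measurable_standardize n).aemeasurable]
    exact hY.integrable_comp n fun x ↦ f ((x - ∫ ω, Y n ω ∂μ) / √(variance (Y n) μ))
  · rw [integral_map (hY.measurable_standardize n).aemeasurable
      hf.continuous.aestronglyMeasurable]
    have h := hY.integral_comp n fun x ↦ f ((x - ∫ ω, Y n ω ∂μ) / √(variance (Y n) μ))
    change |∫ ω, f ((Y n ω - ∫ ω, Y n ω ∂μ) / √(variance (Y n) μ)) ∂μ - _| ≤ _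
    rw [h, hY.integral_eq_countMean, hY.variance_eq_countVar]
    exact hC hf n hn

end IsComparisonCount

namespace ComparisonCount

/-! ### From test functions to weak convergence -/

theorem isTestFunction_cos {t : ℝ} (ht : t ≠ 0) :
    IsTestFunction (fun x ↦ Real.cos (t * x) / |t| ^ 3) (fun x ↦ -(t * Real.sin (t * x)) / |t| ^ 3)
      (fun x ↦ -(t ^ 2 * Real.cos (t * x)) / |t| ^ 3) where
  hasDerivAt x := by
    have h := (((Real.hasDerivAt_cos (t * x)).comp x ((hasDerivAt_id x).const_mul t))).div_const
      (|t| ^ 3)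
    exact h.congr_deriv (by simp; ring)
  hasDerivAt' x := by
    have h := (((Real.hasDerivAt_sin (t * x)).comp x ((hasDerivAt_id x).const_mul t)).const_mul
      t).neg.div_const (|t| ^ 3)
    exact h.congr_deriv (by simp; ring)
  lipschitz x y := by
    have h := Real.abs_cos_sub_cos_le (t * x) (t * y)
    have ht' : 0 < |t| := abs_pos.2 ht
    rw [← sub_div, abs_div, abs_of_pos (by positivity : 0 < |t| ^ 3), div_le_iff₀ (by positivity),
      show -(t ^ 2 * Real.cos (t * x)) - -(t ^ 2 * Real.cos (t * y))
        = -(t ^ 2 * (Real.cos (t * x) - Real.cos (t * y))) by ring, abs_neg, abs_mul, abs_pow]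
    calc |t| ^ 2 * |Real.cos (t * x) - Real.cos (t * y)| ≤ |t| ^ 2 * |t * x - t * y| := by gcongr
      _ = |x - y| * |t| ^ 3 := by rw [← mul_sub, abs_mul]; ring

theorem isTestFunction_sin {t : ℝ} (ht : t ≠ 0) :
    IsTestFunction (fun x ↦ Real.sin (t * x) / |t| ^ 3) (fun x ↦ (t * Real.cos (t * x)) / |t| ^ 3)
      (fun x ↦ -(t ^ 2 * Real.sin (t * x)) / |t| ^ 3) where
  hasDerivAt x := by
    have h := (((Real.hasDerivAt_sin (t * x)).comp x ((hasDerivAt_id x).const_mul t))).div_const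
      (|t| ^ 3)
    exact h.congr_deriv (by simp; ring)
  hasDerivAt' x := by
    have h := (((Real.hasDerivAt_cos (t * x)).comp x ((hasDerivAt_id x).const_mul t)).const_mul
      t).div_const (|t| ^ 3)
    exact h.congr_deriv (by simp; ring)
  lipschitz x y := by
    have h := Real.abs_sin_sub_sin_le (t * x) (t * y)
    have ht' : 0 < |t| := abs_pos.2 ht
    rw [← sub_div, abs_div, abs_of_pos (by positivity : 0 < |t| ^ 3), div_le_iff₀ (by positivity),
      show -(t ^ 2 * Real.sin (t * x)) - -(t ^ 2 * Real.sin (t * y))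
        = -(t ^ 2 * (Real.sin (t * x) - Real.sin (t * y))) by ring, abs_neg, abs_mul, abs_pow]
    calc |t| ^ 2 * |Real.sin (t * x) - Real.sin (t * y)| ≤ |t| ^ 2 * |t * x - t * y| := by gcongr
      _ = |x - y| * |t| ^ 3 := by rw [← mul_sub, abs_mul]; ring

theorem charFun_eq_cos_add_sin (P : Measure ℝ) [IsProbabilityMeasure P] (t : ℝ) :
    charFun P t = ((∫ x, Real.cos (t * x) ∂P : ℝ) : ℂ)
      + ((∫ x, Real.sin (t * x) ∂P : ℝ) : ℂ) * Complex.I := by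
  have hc : Integrable (fun x ↦ ((Real.cos (t * x) : ℝ) : ℂ)) P :=
    Integrable.of_bound (by fun_prop) 1 (Eventually.of_forall fun x ↦ by
      rw [Complex.norm_real]; exact Real.abs_cos_le_one _)
  have hs : Integrable (fun x ↦ ((Real.sin (t * x) : ℝ) : ℂ) * Complex.I) P :=
    Integrable.of_bound (by fun_prop) 1 (Eventually.of_forall fun x ↦ by
      rw [norm_mul, Complex.norm_real, Complex.norm_I, mul_one]; exact Real.abs_sin_le_one _)
  rw [charFun_apply_real, ← integral_complex_ofReal, ← integral_complex_ofReal,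
    ← integral_mul_const, ← integral_add hc hs]
  congr 1
  funext x
  rw [← Complex.ofReal_mul, Complex.exp_mul_I, Complex.ofReal_cos, Complex.ofReal_sin]

/-- Laws that agree up to `r` on all test functions have characteristic functions that differ by
at most `2 |t|³ r` at `t`. -/
theorem norm_charFun_sub_le {P Q : Measure ℝ} [IsProbabilityMeasure P] [IsProbabilityMeasure Q]
    {r : ℝ} (h : ∀ {f f' f'' : ℝ → ℝ}, IsTestFunction f f' f'' →
      |∫ x, f x ∂P - ∫ x, f x ∂Q| ≤ r) (t : ℝ) :
    ‖charFun P t - charFun Q t‖ ≤ 2 * |t| ^ 3 * r := by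
  rcases eq_or_ne t 0 with rfl | ht
  · simp
  have ht' : 0 < |t| ^ 3 := by positivity
  have hc := h (isTestFunction_cos ht)
  have hs := h (isTestFunction_sin ht)
  rw [integral_div, integral_div, ← sub_div, abs_div, abs_of_pos ht', div_le_iff₀ ht'] at hc hs
  rw [charFun_eq_cos_add_sin, charFun_eq_cos_add_sin, add_sub_add_comm, ← Complex.ofReal_sub,
    ← sub_mul, ← Complex.ofReal_sub]
  refine (norm_add_le _ _).trans ?_
  rw [norm_mul, Complex.norm_I, mul_one, Complex.norm_real, Complex.norm_real, Real.norm_eq_abs,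
    Real.norm_eq_abs]
  linarith

/-- Approximation on test functions implies weak convergence, also after multiplication with
constants that converge to `1`. -/
theorem tendstoInDistribution_mul {Ω : Type*} [MeasurableSpace Ω] {μ : Measure Ω}
    [IsProbabilityMeasure μ] {X : ℕ → Ω → ℝ} (hX : ∀ n, Measurable (X n)) {a r : ℕ → ℝ}
    (h : ∀ᶠ n in atTop, ∀ {f f' f'' : ℝ → ℝ}, IsTestFunction f f' f'' →
      |∫ x, f x ∂(μ.map (X n)) - ∫ x, f x ∂stdNormal| ≤ r n)
    (hr : Tendsto r atTop (nhds 0)) (ha : Tendsto a atTop (nhds 1)) :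
    TendstoInDistribution (fun n ω ↦ a n * X n ω) atTop id (fun _ ↦ μ) stdNormal where
  forall_aemeasurable n := ((hX n).const_mul _).aemeasurable
  tendsto := by
    refine ProbabilityMeasure.tendsto_iff_tendsto_charFun.2 fun t ↦ ?_
    simp only [ProbabilityMeasure.coe_mk, Measure.map_id]
    have hP : ∀ n, IsProbabilityMeasure (μ.map (X n)) := fun n ↦
      Measure.isProbabilityMeasure_map (hX n).aemeasurable
    have hmul : ∀ n, charFun (μ.map fun ω ↦ a n * X n ω) t = charFun (μ.map (X n)) (a n * t) := by
      intro n
      have : μ.map (fun ω ↦ a n * X n ω) = (μ.map (X n)).map (a n * ·) := by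
        rw [Measure.map_map (by fun_prop) (hX n)]; rfl
      rw [this, charFun_map_mul]
    simp only [hmul]
    have hat : Tendsto (fun n ↦ a n * t) atTop (nhds t) := by
      simpa using ha.mul_const t
    have h1 : Tendsto (fun n ↦ charFun stdNormal (a n * t)) atTop (nhds (charFun stdNormal t)) :=
      (continuous_charFun.tendsto t).comp hat
    have h2 : Tendsto (fun n ↦ charFun (μ.map (X n)) (a n * t) - charFun stdNormal (a n * t))
        atTop (nhds 0) := by
      refine squeeze_zero_norm' (h.mono fun n hn ↦ norm_charFun_sub_le hn (a n * t)) ?_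
      have := ((hat.abs.pow 3).const_mul 2).mul hr
      simpa using this
    simpa using h2.add h1

end ComparisonCount

namespace IsComparisonCount

open ComparisonCount

variable {Ω : Type*} [MeasurableSpace Ω] {μ : Measure Ω} [IsProbabilityMeasure μ]
  {Y : ℕ → Ω → ℝ}

theorem exists_zolotarevDist_le (hY : IsComparisonCount μ Y) :
    ∃ C : ℝ, ∀ n : ℕ, 2 ≤ n →
      zolotarevDist (μ.map (standardize μ (Y n))) (gaussianReal 0 1) ≤
        ENNReal.ofReal (C / √(Real.log n)) := by
  obtain ⟨C, hC0, hC⟩ := hY.exists_abs_integral_standardize_sub_le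
  refine ⟨C, fun n hn ↦ iSup₂_le fun f hf ↦ ?_⟩
  obtain ⟨f', f'', hf⟩ := mem_zolotarevClass_iff.1 hf
  have hint : Integrable f (gaussianReal 0 1) := by
    simpa using hf.hasCubicGrowth.integrable 0 1
  rw [if_pos ⟨(hC hf n hn).1, hint⟩]
  exact ENNReal.ofReal_le_ofReal (hC hf n hn).2

theorem tendstoInDistribution_mul_standardize (hY : IsComparisonCount μ Y) {a : ℕ → ℝ}
    (ha : Tendsto a atTop (nhds 1)) :
    TendstoInDistribution (fun n ω ↦ a n * standardize μ (Y n) ω) atTop id (fun _ ↦ μ)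
      (gaussianReal 0 1) := by
  obtain ⟨C, hC0, hC⟩ := hY.exists_abs_integral_standardize_sub_le
  refine tendstoInDistribution_mul (r := fun n : ℕ ↦ C / √(Real.log n)) hY.measurable_standardize
    (eventually_atTop.2 ⟨2, fun n hn _ _ _ hf ↦ (hC hf n hn).2⟩) ?_ ha
  exact tendsto_const_nhds.div_atTop
    (Real.tendsto_sqrt_atTop.comp (Real.tendsto_log_atTop.comp tendsto_natCast_atTop_atTop))

theorem tendstoInDistribution_standardize (hY : IsComparisonCount μ Y) :
    TendstoInDistribution (fun n ↦ standardize μ (Y n)) atTop id (fun _ ↦ μ)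
      (gaussianReal 0 1) := by
  simpa using hY.tendstoInDistribution_mul_standardize (a := fun _ ↦ 1) tendsto_const_nhds

theorem exists_tendstoInDistribution_div_log (hY : IsComparisonCount μ Y) :
    ∃ σ : ℝ, 0 < σ ∧
      TendstoInDistribution (fun (n : ℕ) ω ↦ (Y n ω - ∫ ω', Y n ω' ∂μ) / (σ * √(Real.log n)))
        atTop id (fun _ ↦ μ) (gaussianReal 0 1) := by
  obtain ⟨s, hs, hlim⟩ := hY.isCountLaw.exists_tendsto_countVar_div_log
  refine ⟨√s, Real.sqrt_pos.2 hs, ?_⟩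
  have ha : Tendsto (fun n : ℕ ↦ √(countVar (countProb μ Y) n / (s * Real.log n))) atTop
      (nhds 1) := by
    simpa using hlim.sqrt
  have e : (fun (n : ℕ) ω ↦ (Y n ω - ∫ ω', Y n ω' ∂μ) / (√s * √(Real.log n))) =
      fun n ω ↦ √(countVar (countProb μ Y) n / (s * Real.log n)) * standardize μ (Y n) ω := by
    funext n ω
    rcases lt_or_ge n 2 with hn | hn
    · -- here `log n = 0`, and both sides are `0` by the convention for division by zero
      have : Real.log n = 0 := by interval_cases n <;> simp
      simp [this]
    · have hv : √(countVar (countProb μ Y) n) ≠ 0 :=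
        (Real.sqrt_pos.2 (hY.isCountLaw.countVar_pos hn)).ne'
      rw [standardize, hY.variance_eq_countVar, Real.sqrt_div' _ (by positivity),
        Real.sqrt_mul hs.le]
      field_simp
  rw [e]
  exact hY.tendstoInDistribution_mul_standardize ha

end IsComparisonCount

theorem corollary5p4 {Ω : Type*} [MeasurableSpace Ω] (μ : Measure Ω) [IsProbabilityMeasure μ]
    (Y : ℕ → Ω → ℝ) (hY : IsComparisonCount μ Y) :
    (∃ C : ℝ, ∀ n : ℕ, 2 ≤ n →
      zolotarevDist (μ.map (standardize μ (Y n))) (gaussianReal 0 1) ≤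
        ENNReal.ofReal (C / √(Real.log n))) ∧
    TendstoInDistribution (fun n ↦ standardize μ (Y n)) atTop id (fun _ ↦ μ)
      (gaussianReal 0 1) ∧
    (∃ σ : ℝ, 0 < σ ∧
      TendstoInDistribution (fun (n : ℕ) ω ↦ (Y n ω - ∫ ω', Y n ω' ∂μ) / (σ * √(Real.log n)))
        atTop id (fun _ ↦ μ) (gaussianReal 0 1)) :=
  ⟨hY.exists_zolotarevDist_le, hY.tendstoInDistribution_standardize,
    hY.exists_tendstoInDistribution_div_log⟩
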